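/- A trajectory with $k\ge 1$ segments is a polygonal path in $\mathbb{R}^2$ given by $k+1$ waypoints (repetitions allowed), identified with the union of its $k$ closed segments. Let $\mathcal T$ be a family of $n\ge1$ such trajectories, let $r^*$ be the minimal radius of a closed ball that touches (i.e. meets) every $T\in\mathcal T$, let $\Delta_{\mathcal T}$ be the diameter of $\bigcup_{T\in\mathcal T}T$, and write $\operatorname{dist}(x,Z)=\min_{z\in Z}\|x-z\|$ and $\log^+x=\max\{\log x,0\}$ ($\log^+0=0$). For $\varepsilon,\rho\ge 0$, an $(\varepsilon,\rho)$-approximate trajectory minimum touching ball (TMTB) is a closed ball that touches every $T\in\mathcal T$ and has radius at most $(1+\varepsilon)\max\{r^*,\rho\}$. Procedure EstimateRad$(L,\gamma,\rho,\tau)$, for a list $L$ of segments: for each segment $\ell$ of $L$ in turn, while $\tau>\rho$, compute $F=\{x\in\ell:\operatorname{dist}(x,T')\le\tau\text{ for all }T'\in\mathcal T\}$ from the intervals in which $\ell$ is within $\tau$ of the segments of the trajectories, by sorting the ends of these intervals along $\ell$; if $F=\emptyset$ go on to the next segment, otherwise record a point of $F$ as current center and replace $\tau$ by $\tau/\gamma$.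 At the end return the ball with the current center and radius $\gamma\tau$. The search starts from a given center. Algorithm EstimateTMBT$(\mathcal T,\varepsilon,\rho)$: (1) Choose any $T\in\mathcal T$; let $x$ be its first waypoint and $\hat\Delta$ the largest distance from $x$ to a point of a trajectory of $\mathcal T$; run EstimateRad on the segments of $T$ with $\gamma=2$, starting from center $x$ and threshold $2\hat\Delta$. This gives a ball of radius $\tau$. (2) For every integer $i$ with $|i|\le 12/\varepsilon$ form the ghost trajectory $G_i$, consisting of one segment for each segment $\ell$ of $T$, namely $\ell$ shifted by $i\varepsilon\tau/12$ along its normal and extended by $\tau$ at both ends (for a one-point segment a fixed direction is used). (3) Return the result of EstimateRad on all segments of all $G_i$ with $\gamma=1+\varepsilon/3$, starting from the center and radius $\tau$ of the ball from (1). Theorem. Let $0<\varepsilon\le 1/2$, $\rho\ge0$ and $\max\{r^*,\rho\}>0$. For every choice of $T$ in step (1), EstimateTMBT terminates and returns an $(\varepsilon,\rho)$-approximate TMTB of $\mathcal T$, and on a unit-cost real RAM (with square roots) it runs in time $$O\Big(nk\log(nk+1)\,\tfrac1\varepsilon\big(\log^+(\Delta_{\mathcal T}/\max\{r^*,\rho\})+k\big)\Big)$$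 with an absolute constant. Moreover, the ball found in step (1) is a $(3,\rho)$-approximate TMTB; there are at most $25/\varepsilon$ ghost trajectories, each with $k$ segments; and every point $x$ with $\operatorname{dist}(x,T)\le\tau$ is at distance at most $\varepsilon\tau/12$ from some ghost trajectory. -/

import Mathlib

noncomputable section

namespace TMTB

/-! ### Trajectories and touching balls in the plane -/

/-- The Euclidean plane. -/
abbrev Point := EuclideanSpace ℝ (Fin 2)

/-- A trajectory with `k` segments, given by its `k + 1` waypoints. Waypoints may repeat, so a
trajectory with fewer segments is also one with `k` segments. -/
abbrev Trajectory (k : ℕ) := Fin (k + 1) → Point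

/-- The points of a trajectory: the union of its `k` segments (used for `1 ≤ k`). -/
def carrier {k : ℕ} (T : Trajectory k) : Set Point :=
  ⋃ j : Fin k, segment ℝ (T j.castSucc) (T j.succ)

/-- A center together with a radius. -/
structure Ball where
  center : Point
  radius : ℝ

/-- The closed ball meets the set `Z`. -/
def Touches (B : Ball) (Z : Set Point) : Prop :=
  (Z ∩ Metric.closedBall B.center B.radius).Nonempty

/-- The ball meets every trajectory of the family. -/
def TouchesAll {n k : ℕ} (B : Ball) (𝒯 : Fin n → Trajectory k) : Prop :=
  ∀ i, Touches B (carrier (𝒯 i))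

/-- The radius `r*` of a minimum touching ball. -/
def minRadius {n k : ℕ} (𝒯 : Fin n → Trajectory k) : ℝ :=
  sInf {r : ℝ | ∃ c : Point, TouchesAll ⟨c, r⟩ 𝒯}

/-- `B` is an `(ε, ρ)`-approximate trajectory minimum touching ball. -/
def IsApproxTMTB {n k : ℕ} (ε ρ : ℝ) (𝒯 : Fin n → Trajectory k) (B : Ball) : Prop :=
  TouchesAll B 𝒯 ∧ B.radius ≤ (1 + ε) * max (minRadius 𝒯) ρ

/-- The diameter of the set of all points of all trajectories. -/
def diameter {n k : ℕ} (𝒯 : Fin n → Trajectory k) : ℝ :=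
  Metric.diam (⋃ i, carrier (𝒯 i))

/-- The `τ`-sausage of a trajectory. -/
def sausage {k : ℕ} (T : Trajectory k) (τ : ℝ) : Set Point :=
  {x | Metric.infDist x (carrier T) ≤ τ}

/-- A line segment, by its end points. -/
structure Seg where
  p : Point
  q : Point

/-- The points of a line segment. -/
def Seg.points (s : Seg) : Set Point := segment ℝ s.p s.q

/-! ### Step counting

The cost model is the unit-cost real RAM: every arithmetic operation on reals, every square root
and every comparison costs one step, and so does every list cell that is read, written or copied.
-/

/-- The result of a terminating computation and the number of steps it took. -/
structure Timed (α : Type) where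
  val : α
  cost : ℕ

instance : Monad Timed where
  pure a := ⟨a, 0⟩
  bind x f := ⟨(f x.val).val, x.cost + (f x.val).cost⟩

/-- A computation that may fail to terminate. -/
def Program (α : Type) : Type := Part (Timed α)

instance : Monad Program where
  pure a := Part.some ⟨a, 0⟩
  bind x f := Part.bind x fun u => Part.map (fun v => ⟨v.val, u.cost + v.cost⟩) (f u.val)

instance : MonadLift Timed Program where
  monadLift x := Part.some x

/-- The program terminates with result `a` after exactly `t` steps. -/
def Program.Returns {α : Type} (x : Program α) (a : α) (t : ℕ) : Prop :=
  Membership.mem (γ := Part (Timed α)) x ⟨a, t⟩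

/-- Repeat `body` on the state until it yields a result (`Sum.inl`), adding up the steps. -/
def loop {σ β : Type} (body : σ → Timed (β ⊕ σ)) (s : σ) : Program β :=
  PFun.fix (fun st : σ × ℕ => Part.some
    (match body st.1 with
      | ⟨Sum.inl b, c⟩ => (Sum.inl ⟨b, st.2 + c⟩ : Timed β ⊕ (σ × ℕ))
      | ⟨Sum.inr s', c⟩ => Sum.inr (s', st.2 + c))) (s, 0)

/-- Spend `t` steps. -/
def spend (t : ℕ) : Timed Unit := ⟨(), t⟩

def add (x y : ℝ) : Timed ℝ := ⟨x + y, 1⟩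
def sub (x y : ℝ) : Timed ℝ := ⟨x - y, 1⟩
def mul (x y : ℝ) : Timed ℝ := ⟨x * y, 1⟩
def div (x y : ℝ) : Timed ℝ := ⟨x / y, 1⟩
def sqrt (x : ℝ) : Timed ℝ := ⟨Real.sqrt x, 1⟩
def le (x y : ℝ) : Timed Bool := ⟨decide (x ≤ y), 1⟩
def lt (x y : ℝ) : Timed Bool := ⟨decide (x < y), 1⟩

/-- Concatenation copies the first list. -/
def append {α : Type} (xs ys : List α) : Timed (List α) := ⟨xs ++ ys, xs.length + 1⟩

/-- Apply a computation to every entry of a list. -/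
def mapList {α β : Type} (f : α → Timed β) : List α → Timed (List β)
  | [] => do
    spend 1
    return []
  | x :: xs => do
    spend 1
    let y ← f x
    let ys ← mapList f xs
    return y :: ys

/-- Concatenate a list of lists. -/
def flatten {α : Type} : List (List α) → Timed (List α)
  | [] => do
    spend 1
    return []
  | xs :: xss => do
    spend 1
    let ys ← flatten xss
    append xs ys

/-- The maximum of the entries of a list and of `m`. -/
def maxList (m : ℝ) : List ℝ → Timed ℝ
  | [] => do
    spend 1
    return m
  | x :: xs => do
    spend 1
    if ← le m x then maxList x xs else maxList m xs

/-- Merge two lists that are sorted by the key `Prod.fst`. -/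
def merge {α : Type} : List (ℝ × α) → List (ℝ × α) → Timed (List (ℝ × α))
  | [], ys => do
    spend 1
    return ys
  | x :: xs, [] => do
    spend 1
    return x :: xs
  | x :: xs, y :: ys => do
    spend 1
    if ← le x.1 y.1 then
      let zs ← merge xs (y :: ys)
      return x :: zs
    else
      let zs ← merge (x :: xs) ys
      return y :: zs
  termination_by xs ys => xs.length + ys.length

/-- Merge sort by the key `Prod.fst`. -/
def mergeSort {α : Type} : List (ℝ × α) → Timed (List (ℝ × α))
  | [] => do
    spend 1
    return []
  | [x] => do
    spend 1
    return [x]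
  | x :: y :: l => do
    spend (x :: y :: l).length
    let xs ← mergeSort ((x :: y :: l).take ((x :: y :: l).length / 2))
    let ys ← mergeSort ((x :: y :: l).drop ((x :: y :: l).length / 2))
    merge xs ys
  termination_by l => l.length
  decreasing_by all_goals (simp; omega)

/-! ### Constant-time geometry -/

def vadd (a b : Point) : Timed Point := do
  let x ← add (a 0) (b 0)
  let y ← add (a 1) (b 1)
  return !₂[x, y]

def vsub (a b : Point) : Timed Point := do
  let x ← sub (a 0) (b 0)
  let y ← sub (a 1) (b 1)
  return !₂[x, y]

def smul (t : ℝ) (a : Point) : Timed Point := do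
  let x ← mul t (a 0)
  let y ← mul t (a 1)
  return !₂[x, y]

def dot (a b : Point) : Timed ℝ := do
  let x ← mul (a 0) (b 0)
  let y ← mul (a 1) (b 1)
  add x y

def cross (a b : Point) : Timed ℝ := do
  let x ← mul (a 0) (b 1)
  let y ← mul (a 1) (b 0)
  sub x y

/-- Euclidean distance. -/
def distance (a b : Point) : Timed ℝ := do
  let w ← vsub a b
  let s ← dot w w
  sqrt s

/-- The intersection of two closed intervals, `none` if it is empty. -/
def meet (I J : ℝ × ℝ) : Timed (Option (ℝ × ℝ)) := do
  let lo ← (do if ← le I.1 J.1 then return J.1 else return I.1 : Timed ℝ)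
  let hi ← (do if ← le I.2 J.2 then return I.2 else return J.2 : Timed ℝ)
  if ← le lo hi then return some (lo, hi) else return none

/-- The part of the interval `I` on which `lo ≤ α + β * t ≤ hi`. -/
def clip (lo hi α β : ℝ) (I : ℝ × ℝ) : Timed (Option (ℝ × ℝ)) := do
  let u ← sub lo α
  let v ← sub hi α
  if ← lt 0 β then
    let x ← div u β
    let y ← div v β
    meet (x, y) I
  else if ← lt β 0 then
    let x ← div v β
    let y ← div u β
    meet (x, y) I
  else if ← le u 0 then
    if ← le 0 v then return some I else return none
  else return none

/-- The parameters `t` in `[0, 1]` for which `a + t • d` has distance at most `τ` from `c`. -/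
def diskInterval (a d c : Point) (τ : ℝ) : Timed (Option (ℝ × ℝ)) := do
  let w ← vsub a c
  let A ← dot d d
  let B ← dot d w
  let W ← dot w w
  let τ2 ← mul τ τ
  let C ← sub W τ2
  if ← lt 0 A then
    let B2 ← mul B B
    let AC ← mul A C
    let D ← sub B2 AC
    if ← le 0 D then
      let s ← sqrt D
      let b ← sub 0 B
      let u ← sub b s
      let v ← add b s
      let x ← div u A
      let y ← div v A
      meet (x, y) (0, 1)
    else return none
  else if ← le C 0 then return some (0, 1)
  else return none

/-- The parameters `t` in `[0, 1]` for which the orthogonal projection of `a + t • d` to the line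
through the ends of the nondegenerate segment `s` lies on `s`, at distance at most `τ`. -/
def slabInterval (a d : Point) (s : Seg) (τ : ℝ) : Timed (Option (ℝ × ℝ)) := do
  let e ← vsub s.q s.p
  let L ← dot e e
  if ← lt 0 L then
    let w ← vsub a s.p
    let α ← dot e w
    let β ← dot e d
    let I ← clip 0 L α β (0, 1)
    match I with
    | none => return none
    | some J =>
      let len ← sqrt L
      let h ← mul τ len
      let h' ← sub 0 h
      let α' ← cross e w
      let β' ← cross e d
      clip h' h α' β' J
  else return none

/-- At most three closed intervals whose union is the set of all `t` in `[0, 1]` for which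
`a + t • d` has distance at most `τ` from the segment `s`. -/
def nearIntervals (a d : Point) (τ : ℝ) (s : Seg) : Timed (List (ℝ × ℝ)) := do
  let I ← diskInterval a d s.p τ
  let J ← diskInterval a d s.q τ
  let K ← slabInterval a d s τ
  spend 3
  return I.toList ++ J.toList ++ K.toList

/-! ### The algorithms -/

/-- Read the segments of a trajectory. -/
def readSegments {k : ℕ} (T : Trajectory k) : Timed (List Seg) := do
  spend (k + 1)
  return List.ofFn fun j : Fin k => ⟨T j.castSucc, T j.succ⟩

/-- Read the whole input: every index with the segments of its trajectory. -/
def readInput {n k : ℕ} (𝒯 : Fin n → Trajectory k) : Timed (List (Fin n × List Seg)) := do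
  spend (n + 1)
  mapList (fun i => do
    let S ← readSegments (𝒯 i)
    return (i, S)) (List.finRange n)

/-- The distance from `x` to a furthest point of any trajectory. -/
def furthest {n : ℕ} (x : Point) (𝒮 : List (Fin n × List Seg)) : Timed ℝ := do
  let ds ← mapList (fun S : Fin n × List Seg => do
    let es ← mapList (fun s : Seg => do
      let u ← distance x s.p
      let v ← distance x s.q
      maxList u [v]) S.2
    maxList 0 es) 𝒮
  maxList 0 ds

/-- The intervals of all trajectories on the segment from `a` to `a + d`: lower end, upper end and
the index of the trajectory. -/
def allIntervals {n : ℕ} (𝒮 : List (Fin n × List Seg)) (a d : Point) (τ : ℝ) :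
    Timed (List (ℝ × ℝ × Fin n)) := do
  let Is ← mapList (fun S : Fin n × List Seg => do
    let Js ← mapList (nearIntervals a d τ) S.2
    let J ← flatten Js
    mapList (fun I : ℝ × ℝ => (do
      spend 1
      return (I.1, I.2, S.1) : Timed (ℝ × ℝ × Fin n))) J) 𝒮
  flatten Is

/-- Sweep over the sorted lower ends (first list) and the sorted upper ends (second list). The array
`cnt` holds for every trajectory the number of its intervals that are open, and `active` is the
number of trajectories with an open interval. Returns a point at which all `n` are active. -/
def sweep {n : ℕ} (cnt : Fin n → ℕ) (active : ℕ) :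
    List (ℝ × Fin n) → List (ℝ × Fin n) → Timed (Option ℝ)
  | [], _ => do
    spend 1
    return none
  | _ :: _, [] => do
    spend 1
    return none
  | x :: xs, y :: ys => do
    spend 5
    if ← le x.1 y.1 then
      if (if cnt x.2 = 0 then active + 1 else active) = n then
        return some x.1
      else
        sweep (Function.update cnt x.2 (cnt x.2 + 1))
          (if cnt x.2 = 0 then active + 1 else active) xs (y :: ys)
    else
      sweep (Function.update cnt y.2 (cnt y.2 - 1))
        (if cnt y.2 = 1 then active - 1 else active) (x :: xs) ys
  termination_by xs ys => xs.length + ys.length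

/-- A point of the feasible region of the segment `s`, i.e. a point of `s` at distance at most `τ`
from every trajectory; `none` if the feasible region is empty. -/
def feasiblePoint {n : ℕ} (𝒮 : List (Fin n × List Seg)) (s : Seg) (τ : ℝ) :
    Timed (Option Point) := do
  let d ← vsub s.q s.p
  let Is ← allIntervals 𝒮 s.p d τ
  let los ← mapList (fun I : ℝ × ℝ × Fin n => (do
    spend 1
    return (I.1, I.2.2) : Timed (ℝ × Fin n))) Is
  let his ← mapList (fun I : ℝ × ℝ × Fin n => (do
    spend 1
    return (I.2.1, I.2.2) : Timed (ℝ × Fin n))) Is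
  let los' ← mergeSort los
  let his' ← mergeSort his
  spend (n + 1)
  let t ← sweep (fun _ => 0) 0 los' his'
  match t with
  | none => return none
  | some t =>
    let v ← smul t d
    let c ← vadd s.p v
    return some c

/-- One round of the search. The state holds the segments that are still to be searched, the current
center and, as the radius, the current threshold `τ`. -/
def estimateRadBody {n : ℕ} (𝒮 : List (Fin n × List Seg)) (γ ρ : ℝ) (st : List Seg × Ball) :
    Timed (Ball ⊕ (List Seg × Ball)) := do
  spend 1
  match st.1 with
  | [] =>
    let r ← mul γ st.2.radius
    return Sum.inl ⟨st.2.center, r⟩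
  | s :: L =>
    if ← lt ρ st.2.radius then
      let c ← feasiblePoint 𝒮 s st.2.radius
      match c with
      | none => return Sum.inr (L, st.2)
      | some c =>
        let τ ← div st.2.radius γ
        return Sum.inr (s :: L, ⟨c, τ⟩)
    else return Sum.inr (L, st.2)

/-- EstimateRad: for every segment of the list `L`, shrink the threshold by the factor `γ` as long as
it exceeds `ρ` and the feasible region of the segment is nonempty; at the end return `γ` times the
threshold, with the last center that was found. The search starts from the center and the
threshold given by `B`. -/
def estimateRad {n : ℕ} (𝒮 : List (Fin n × List Seg)) (L : List Seg) (γ ρ : ℝ) (B : Ball) :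
    Program Ball :=
  loop (estimateRadBody 𝒮 γ ρ) (L, B)

/-- The segment parallel to `s`, offset by `i * (τ * ε / 12)` along the normal of `s` and extended
by `τ` at both ends. If `s` is a single point, the direction `(1, 0)` is used. -/
def ghostSegment (ε τ i : ℝ) (s : Seg) : Timed Seg := do
  let e ← vsub s.q s.p
  let L ← dot e e
  let len ← sqrt L
  let u ← (do
    if ← lt 0 len then
      let x ← div (e 0) len
      let y ← div (e 1) len
      return !₂[x, y]
    else return !₂[1, 0] : Timed Point)
  let m ← sub 0 (u 1)
  let δ ← mul τ ε
  let δ' ← div δ 12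
  let o ← mul i δ'
  let shift ← smul o !₂[m, u 0]
  let ext ← smul τ u
  let p ← vadd s.p shift
  let q ← vadd s.q shift
  let p' ← vsub p ext
  let q' ← vadd q ext
  return ⟨p', q'⟩

/-- The `i`-th ghost trajectory: one parallel segment for every segment of the trajectory. -/
def ghostTrajectory (ε τ : ℝ) (S : List Seg) (i : ℝ) : Timed (List Seg) :=
  mapList (ghostSegment ε τ i) S

/-- One round of the construction of the ghost trajectories; the state holds the next positive
index and the ghost trajectories found so far. -/
def ghostsBody (ε τ : ℝ) (S : List Seg) (st : ℝ × List (List Seg)) :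
    Timed (List (List Seg) ⊕ (ℝ × List (List Seg))) := do
  spend 2
  let x ← mul st.1 ε
  if ← le x 12 then
    let G ← ghostTrajectory ε τ S st.1
    let j ← sub 0 st.1
    let H ← ghostTrajectory ε τ S j
    let i ← add st.1 1
    return Sum.inr (i, G :: H :: st.2)
  else return Sum.inl st.2

/-- The ghost trajectories, for all integers `i` with `|i| ≤ 12 / ε`. -/
def ghosts (ε τ : ℝ) (S : List Seg) : Program (List (List Seg)) := do
  let G ← ghostTrajectory ε τ S 0
  loop (ghostsBody ε τ S) (1, [G])

/-- The returned ball, together with the intermediate results of the run. -/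
structure Outcome where
  /-- the ball found in the first step; its radius is the estimate `τ` -/
  estimate : Ball
  /-- the ghost trajectories, each as a list of segments -/
  ghosts : List (List Seg)
  /-- the ball that is returned -/
  ball : Ball

/-- EstimateTMBT, with the trajectory of index `i₀` as the chosen one. -/
def estimateTMBT {n k : ℕ} (𝒯 : Fin n → Trajectory k) (i₀ : Fin n) (ε ρ : ℝ) :
    Program Outcome := do
  let 𝒮 ← readInput 𝒯
  let S ← readSegments (𝒯 i₀)
  let Δ ← furthest (𝒯 i₀ 0) 𝒮
  let τ₀ ← mul 2 Δ
  let E ← estimateRad 𝒮 S 2 ρ ⟨𝒯 i₀ 0, τ₀⟩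
  let G ← ghosts ε E.radius S
  let L ← flatten G
  let η ← div ε 3
  let γ ← add 1 η
  let B ← estimateRad 𝒮 L γ ρ E
  return ⟨E, G, B⟩

end TMTB

end

noncomputable section

namespace TMTB

/-! ### Running timed computations -/

section Basic

variable {α β : Type}

@[simp] theorem Timed.val_bind (x : Timed α) (f : α → Timed β) :
    (x >>= f).val = (f x.val).val := rfl

@[simp] theorem Timed.cost_bind (x : Timed α) (f : α → Timed β) :
    (x >>= f).cost = x.cost + (f x.val).cost := rfl

@[simp] theorem Timed.val_pure (a : α) : (pure a : Timed α).val = a := rfl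

@[simp] theorem Timed.cost_pure (a : α) : (pure a : Timed α).cost = 0 := rfl

@[simp] theorem spend_cost (t : ℕ) : (spend t).cost = t := rfl
@[simp] theorem add_val (x y : ℝ) : (add x y).val = x + y := rfl
@[simp] theorem add_cost (x y : ℝ) : (add x y).cost = 1 := rfl
@[simp] theorem sub_val (x y : ℝ) : (sub x y).val = x - y := rfl
@[simp] theorem sub_cost (x y : ℝ) : (sub x y).cost = 1 := rfl
@[simp] theorem mul_val (x y : ℝ) : (mul x y).val = x * y := rfl
@[simp] theorem mul_cost (x y : ℝ) : (mul x y).cost = 1 := rfl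
@[simp] theorem div_val (x y : ℝ) : (div x y).val = x / y := rfl
@[simp] theorem div_cost (x y : ℝ) : (div x y).cost = 1 := rfl
@[simp] theorem sqrt_val (x : ℝ) : (sqrt x).val = Real.sqrt x := rfl
@[simp] theorem sqrt_cost (x : ℝ) : (sqrt x).cost = 1 := rfl
@[simp] theorem le_val (x y : ℝ) : (le x y).val = decide (x ≤ y) := rfl
@[simp] theorem le_cost (x y : ℝ) : (le x y).cost = 1 := rfl
@[simp] theorem lt_val (x y : ℝ) : (lt x y).val = decide (x < y) := rfl
@[simp] theorem lt_cost (x y : ℝ) : (lt x y).cost = 1 := rfl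
@[simp] theorem append_val (xs ys : List α) : (append xs ys).val = xs ++ ys := rfl
@[simp] theorem append_cost (xs ys : List α) : (append xs ys).cost = xs.length + 1 := rfl

@[simp] theorem Timed.val_ite (c : Prop) [Decidable c] (x y : Timed α) :
    (if c then x else y).val = if c then x.val else y.val := by split_ifs <;> rfl

@[simp] theorem Timed.cost_ite (c : Prop) [Decidable c] (x y : Timed α) :
    (if c then x else y).cost = if c then x.cost else y.cost := by split_ifs <;> rfl

end Basic

/-! ### Programs and loops -/

section Programs

variable {α β σ : Type}

theorem Program.Returns.bind {x : Program α} {f : α → Program β} {a : α} {b : β} {s t : ℕ}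
    (hx : x.Returns a s) (hf : (f a).Returns b t) : (x >>= f).Returns b (s + t) := by
  refine Part.mem_bind_iff.2 ⟨⟨a, s⟩, hx, ?_⟩
  exact (Part.mem_map_iff _).2 ⟨⟨b, t⟩, hf, rfl⟩

theorem Program.returns_lift (x : Timed α) : Program.Returns (liftM x) x.val x.cost :=
  Part.mem_some _

theorem Program.returns_pure (a : α) : Program.Returns (pure a) a 0 :=
  Part.mem_some _

/-- The transition function whose fixed point is `loop`. -/
def loopStep (body : σ → Timed (β ⊕ σ)) (st : σ × ℕ) : Part (Timed β ⊕ (σ × ℕ)) :=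
  Part.some
    (match body st.1 with
      | ⟨Sum.inl b, c⟩ => (Sum.inl ⟨b, st.2 + c⟩ : Timed β ⊕ (σ × ℕ))
      | ⟨Sum.inr s', c⟩ => Sum.inr (s', st.2 + c))

/-- The loop, started in the state `s`, ends with result `b` after `t` steps. -/
def LoopRuns (body : σ → Timed (β ⊕ σ)) (s : σ) (b : β) (t : ℕ) : Prop :=
  ∀ a : ℕ, (⟨b, a + t⟩ : Timed β) ∈ PFun.fix (loopStep body) (s, a)

theorem LoopRuns.returns {body : σ → Timed (β ⊕ σ)} {s : σ} {b : β} {t : ℕ}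
    (h : LoopRuns body s b t) : (loop body s).Returns b t := by
  have := h 0
  rw [Nat.zero_add] at this
  have he : loop body s = PFun.fix (loopStep body) (s, 0) := by
    unfold loop
    congr 1
    funext st
    unfold loopStep
    rcases body st.1 with ⟨_ | _, _⟩ <;> rfl
  unfold Program.Returns
  rw [he]
  exact this

theorem LoopRuns.of_inl {body : σ → Timed (β ⊕ σ)} {s : σ} {b : β}
    (h : (body s).val = Sum.inl b) : LoopRuns body s b (body s).cost := by
  intro a
  refine PFun.fix_stop ?_
  rcases hb : body s with ⟨v, c⟩
  rw [hb] at h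
  obtain rfl : v = Sum.inl b := h
  simp [loopStep, hb]

/-- `LoopRuns` quantifies over the initial value of the step counter, so the steps spent in one
round only shift the start of the remaining run. -/
theorem LoopRuns.of_inr {body : σ → Timed (β ⊕ σ)} {s s' : σ} {b : β} {t : ℕ}
    (h : (body s).val = Sum.inr s') (hr : LoopRuns body s' b t) :
    LoopRuns body s b ((body s).cost + t) := by
  intro a
  rcases hb : body s with ⟨v, c⟩
  rw [hb] at h
  obtain rfl : v = Sum.inr s' := h
  have hmem : Sum.inr (s', a + c) ∈ loopStep body (s, a) := by simp [loopStep, hb]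
  rw [PFun.fix_fwd_eq hmem, ← Nat.add_assoc]
  exact hr _

end Programs

/-! ### Lists -/

section Lists

variable {α β : Type}

@[simp] theorem mapList_val (f : α → Timed β) (l : List α) :
    (mapList f l).val = l.map fun x => (f x).val := by
  induction l with
  | nil => simp [mapList]
  | cons x l ih => simp [mapList, ih]

theorem mapList_cost_le (f : α → Timed β) (l : List α) (c : ℕ) (h : ∀ x ∈ l, (f x).cost ≤ c) :
    (mapList f l).cost ≤ (c + 1) * l.length + 1 := by
  induction l with
  | nil => simp [mapList]
  | cons x l ih =>
    have h1 := h x (by simp)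
    have h2 := ih fun y hy => h y (by simp [hy])
    simp only [mapList, Timed.cost_bind, spend_cost, Timed.cost_pure, List.length_cons]
    rw [Nat.mul_succ]
    omega

@[simp] theorem flatten_val (l : List (List α)) : (flatten l).val = l.flatten := by
  induction l with
  | nil => simp [flatten]
  | cons x l ih => simp [flatten, ih]

theorem flatten_cost (l : List (List α)) :
    (flatten l).cost = l.flatten.length + 2 * l.length + 1 := by
  induction l with
  | nil => simp [flatten]
  | cons x l ih => simp [flatten, ih]; omega

theorem length_flatten_le (l : List (List α)) (c : ℕ) (h : ∀ x ∈ l, x.length ≤ c) :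
    l.flatten.length ≤ c * l.length := by
  rw [List.length_flatten, mul_comm]
  simpa using List.sum_le_card_nsmul (l.map List.length) c (by simpa using h)

theorem maxList_cost (m : ℝ) (l : List ℝ) : (maxList m l).cost = 2 * l.length + 1 := by
  induction l generalizing m with
  | nil => simp [maxList]
  | cons x l ih => simp [maxList, ih]; omega

theorem le_maxList (m : ℝ) (l : List ℝ) :
    m ≤ (maxList m l).val ∧ ∀ x ∈ l, x ≤ (maxList m l).val := by
  induction l generalizing m with
  | nil => simp [maxList]
  | cons x l ih =>
    simp only [maxList, Timed.val_bind, le_val, decide_eq_true_eq, Timed.val_ite, List.mem_cons,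
      forall_eq_or_imp]
    split_ifs with h
    · exact ⟨h.trans (ih x).1, ih x⟩
    · exact ⟨(ih m).1, (not_le.1 h).le.trans (ih m).1, (ih m).2⟩

theorem maxList_le {m b : ℝ} {l : List ℝ} (hm : m ≤ b) (hl : ∀ x ∈ l, x ≤ b) :
    (maxList m l).val ≤ b := by
  induction l generalizing m with
  | nil => simpa [maxList]
  | cons x l ih =>
    simp only [List.mem_cons, forall_eq_or_imp] at hl
    simp only [maxList, Timed.val_bind, le_val, decide_eq_true_eq, Timed.val_ite]
    split_ifs
    · exact ih hl.1 hl.2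
    · exact ih hm hl.2

/-- Sorted by the key `Prod.fst`. -/
abbrev SortedByKey (l : List (ℝ × α)) : Prop := l.Pairwise fun x y => x.1 ≤ y.1

/-! ### Merge sort: correctness and cost. -/

theorem merge_perm (xs ys : List (ℝ × α)) : (merge xs ys).val.Perm (xs ++ ys) := by
  fun_induction merge xs ys with
  | case1 ys => simp
  | case2 x xs => simp
  | case3 x xs y ys ih1 ih2 =>
    simp only [Timed.val_bind, le_val, decide_eq_true_eq, Timed.val_ite, Timed.val_pure]
    split_ifs
    · exact ih1.cons x
    · exact (ih2.cons y).trans (List.perm_middle (l₁ := x :: xs)).symm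

theorem merge_sorted {xs ys : List (ℝ × α)} (hx : SortedByKey xs) (hy : SortedByKey ys) :
    SortedByKey (merge xs ys).val := by
  fun_induction merge xs ys with
  | case1 ys => simpa
  | case2 x xs => exact hx
  | case3 x xs y ys ih1 ih2 =>
    simp only [Timed.val_bind, le_val, decide_eq_true_eq, Timed.val_ite, Timed.val_pure]
    have hx' := List.pairwise_cons.1 hx
    have hy' := List.pairwise_cons.1 hy
    split_ifs with h
    · refine List.pairwise_cons.2 ⟨fun z hz => ?_, ih1 hx'.2 hy⟩
      rcases List.mem_append.1 ((merge_perm _ _).mem_iff.1 hz) with hz | hz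
      · exact hx'.1 z hz
      · rcases List.mem_cons.1 hz with rfl | hz
        · exact h
        · exact h.trans (hy'.1 z hz)
    · refine List.pairwise_cons.2 ⟨fun z hz => ?_, ih2 hx hy'.2⟩
      rcases List.mem_append.1 ((merge_perm _ _).mem_iff.1 hz) with hz | hz
      · rcases List.mem_cons.1 hz with rfl | hz
        · exact (not_le.1 h).le
        · exact (not_le.1 h).le.trans (hx'.1 z hz)
      · exact hy'.1 z hz

theorem merge_cost_le (xs ys : List (ℝ × α)) :
    (merge xs ys).cost ≤ 2 * (xs.length + ys.length) + 1 := by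
  fun_induction merge xs ys with
  | case1 ys => simp
  | case2 x xs => simp
  | case3 x xs y ys ih1 ih2 =>
    simp only [Timed.cost_bind, le_val, decide_eq_true_eq, Timed.cost_ite, Timed.cost_pure,
      spend_cost, le_cost, List.length_cons] at *
    split_ifs <;> omega

theorem mergeSort_perm (l : List (ℝ × α)) : (mergeSort l).val.Perm l := by
  fun_induction mergeSort l with
  | case1 => simp
  | case2 x => simp
  | case3 x y l ih1 ih2 =>
    simp only [Timed.val_bind]
    refine (merge_perm _ _).trans ((ih1.append ih2).trans ?_)
    rw [List.take_append_drop]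

theorem mergeSort_sorted (l : List (ℝ × α)) : SortedByKey (mergeSort l).val := by
  fun_induction mergeSort l with
  | case1 => simp
  | case2 x => simp
  | case3 x y l ih1 ih2 => exact merge_sorted ih1 ih2

theorem mergeSort_cost_le (l : List (ℝ × α)) :
    (mergeSort l).cost ≤ 3 * l.length * Nat.clog 2 l.length + 2 * l.length + 1 := by
  -- The bound is strengthened by one for nonempty lists: each half saves a step, which pays for the
  -- extra step of `merge` and restores the saving.
  suffices h : 1 ≤ l.length →
      (mergeSort l).cost + 1 ≤ 3 * l.length * Nat.clog 2 l.length + 2 * l.length by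
    rcases Nat.eq_zero_or_pos l.length with h0 | h0
    · obtain rfl := List.length_eq_zero_iff.1 h0
      simp [mergeSort]
    · have := h h0
      omega
  fun_induction mergeSort l with
  | case1 => simp
  | case2 x => simp
  | case3 x y l ih1 ih2 =>
    intro _
    have hm := merge_cost_le (mergeSort ((x :: y :: l).take ((x :: y :: l).length / 2))).val
      (mergeSort ((x :: y :: l).drop ((x :: y :: l).length / 2))).val
    rw [(mergeSort_perm _).length_eq, (mergeSort_perm _).length_eq] at hm
    simp only [Timed.cost_bind, spend_cost]
    have hN : 2 ≤ (x :: y :: l).length := by simp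
    generalize x :: y :: l = l' at *
    rw [List.length_take] at ih1 hm
    rw [List.length_drop] at ih2 hm
    generalize l'.length = N at *
    -- The ceiling logarithm drops by exactly one at the larger half, which has length `⌈N/2⌉`.
    have hc : Nat.clog 2 N = Nat.clog 2 ((N + 2 - 1) / 2) + 1 := Nat.clog_of_two_le one_lt_two hN
    have h1 := ih1 (by omega)
    have h2 := ih2 (by omega)
    have hmin : min (N / 2) N = N / 2 := by omega
    have hb : N - N / 2 = (N + 2 - 1) / 2 := by omega
    have ha : Nat.clog 2 (N / 2) ≤ Nat.clog 2 ((N + 2 - 1) / 2) :=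
      Nat.clog_mono_right 2 (by omega)
    rw [hmin] at h1 hm
    rw [hb] at h2 hm
    rw [hc]
    have hs : N / 2 + (N + 2 - 1) / 2 = N := by omega
    generalize Nat.clog 2 ((N + 2 - 1) / 2) = c at *
    have h3 : 3 * (N / 2) * Nat.clog 2 (N / 2) ≤ 3 * (N / 2) * c := Nat.mul_le_mul_left _ ha
    have h4 : 3 * N * (c + 1) = 3 * (N / 2) * c + 3 * ((N + 2 - 1) / 2) * c + 3 * N := by
      rw [Nat.mul_succ, ← Nat.add_mul, ← Nat.mul_add, hs]
    omega

end Lists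

/-! ### The sweep -/

section Sweep

variable {n : ℕ}

/-- The number of entries of index `i` with key less than `t`. -/
def countLT (i : Fin n) (t : ℝ) (l : List (ℝ × Fin n)) : ℕ :=
  l.countP fun x => x.2 = i ∧ x.1 < t

/-- The number of entries of index `i` with key at most `t`. -/
def countLE (i : Fin n) (t : ℝ) (l : List (ℝ × Fin n)) : ℕ :=
  l.countP fun x => x.2 = i ∧ x.1 ≤ t

/-- The number of entries of index `i`. -/
def countIdx (i : Fin n) (l : List (ℝ × Fin n)) : ℕ :=
  l.countP fun x => x.2 = i

theorem countLT_cons (i : Fin n) (t : ℝ) (x : ℝ × Fin n) (l : List (ℝ × Fin n)) :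
    countLT i t (x :: l) = countLT i t l + if x.2 = i ∧ x.1 < t then 1 else 0 := by
  simp [countLT, List.countP_cons]

theorem countLE_cons (i : Fin n) (t : ℝ) (x : ℝ × Fin n) (l : List (ℝ × Fin n)) :
    countLE i t (x :: l) = countLE i t l + if x.2 = i ∧ x.1 ≤ t then 1 else 0 := by
  simp [countLE, List.countP_cons]

theorem countIdx_cons (i : Fin n) (x : ℝ × Fin n) (l : List (ℝ × Fin n)) :
    countIdx i (x :: l) = countIdx i l + if x.2 = i then 1 else 0 := by
  simp [countIdx, List.countP_cons]

theorem countLT_eq_zero {i : Fin n} {t : ℝ} {l : List (ℝ × Fin n)} (h : ∀ x ∈ l, t ≤ x.1) :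
    countLT i t l = 0 := by
  rw [countLT, List.countP_eq_zero]
  intro x hx
  simpa using fun _ => h x hx

theorem countLE_eq_zero {i : Fin n} {t : ℝ} {l : List (ℝ × Fin n)} (h : ∀ x ∈ l, t < x.1) :
    countLE i t l = 0 := by
  rw [countLE, List.countP_eq_zero]
  intro x hx
  simpa using fun _ => h x hx

/-- The number of indices with a positive counter. -/
def numActive (cnt : Fin n → ℕ) : ℕ := (Finset.univ.filter fun i => cnt i ≠ 0).card

theorem numActive_eq_iff {cnt : Fin n → ℕ} : numActive cnt = n ↔ ∀ i, cnt i ≠ 0 := by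
  have : numActive cnt = n ↔ numActive cnt = (Finset.univ : Finset (Fin n)).card := by simp
  rw [this, numActive, Finset.card_filter_eq_iff]
  simp

theorem numActive_open (cnt : Fin n → ℕ) (j : Fin n) :
    (if cnt j = 0 then numActive cnt + 1 else numActive cnt) =
      numActive (Function.update cnt j (cnt j + 1)) := by
  unfold numActive
  split_ifs with h
  · rw [← Finset.card_insert_of_notMem (a := j) (by simp [h])]
    congr 1
    ext i
    by_cases hi : i = j <;> simp [hi, Function.update_apply]
  · congr 1
    ext i
    by_cases hi : i = j <;> simp [hi, h, Function.update_apply]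

theorem numActive_close (cnt : Fin n → ℕ) (j : Fin n) (hj : cnt j ≠ 0) :
    (if cnt j = 1 then numActive cnt - 1 else numActive cnt) =
      numActive (Function.update cnt j (cnt j - 1)) := by
  unfold numActive
  split_ifs with h
  · rw [← Finset.card_erase_of_mem (a := j) (by simp [h])]
    congr 1
    ext i
    by_cases hi : i = j <;> simp [hi, h, Function.update_apply]
  · congr 1
    ext i
    by_cases hi : i = j
    · subst hi
      simp
      omega
    · simp [hi, Function.update_apply]

/-- The invariant of the sweep: every interval that is still to be closed is open or still to be
opened, and intervals are opened before they are closed. -/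
structure SweepInv (cnt : Fin n → ℕ) (xs ys : List (ℝ × Fin n)) : Prop where
  sorted_xs : SortedByKey xs
  sorted_ys : SortedByKey ys
  count_le : ∀ i t, countLT i t ys ≤ cnt i + countLT i t xs
  count_eq : ∀ i, countIdx i ys = cnt i + countIdx i xs

theorem SweepInv.opened {cnt : Fin n → ℕ} {x : ℝ × Fin n} {xs ys : List (ℝ × Fin n)}
    (h : SweepInv cnt (x :: xs) ys) :
    SweepInv (Function.update cnt x.2 (cnt x.2 + 1)) xs ys where
  sorted_xs := (List.pairwise_cons.1 h.sorted_xs).2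
  sorted_ys := h.sorted_ys
  count_le i t := by
    have := h.count_le i t
    rw [countLT_cons] at this
    rw [Function.update_apply]
    split_ifs at this ⊢ <;> subst_vars <;> grind
  count_eq i := by
    have := h.count_eq i
    rw [countIdx_cons] at this
    rw [Function.update_apply]
    split_ifs at this ⊢ <;> subst_vars <;> grind

/-- At the threshold `x.1` no unopened interval is counted, while `y` still is; the invariant forces
an open interval of the index of `y`. Hence the subtraction when closing `y` is not truncated. -/
theorem SweepInv.count_pos {cnt : Fin n → ℕ} {x y : ℝ × Fin n} {xs ys : List (ℝ × Fin n)}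
    (h : SweepInv cnt (x :: xs) (y :: ys)) (hxy : y.1 < x.1) : cnt y.2 ≠ 0 := by
  have := h.count_le y.2 x.1
  have hx := List.pairwise_cons.1 h.sorted_xs
  rw [countLT_cons, countLT_eq_zero (l := x :: xs) (by simpa using hx.1)] at this
  simp only [hxy, and_self, if_true] at this
  omega

theorem SweepInv.closed {cnt : Fin n → ℕ} {x y : ℝ × Fin n} {xs ys : List (ℝ × Fin n)}
    (h : SweepInv cnt (x :: xs) (y :: ys)) (hxy : y.1 < x.1) :
    SweepInv (Function.update cnt y.2 (cnt y.2 - 1)) (x :: xs) ys where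
  sorted_xs := h.sorted_xs
  sorted_ys := (List.pairwise_cons.1 h.sorted_ys).2
  count_le i t := by
    have hp := h.count_pos hxy
    have hy := List.pairwise_cons.1 h.sorted_ys
    have := h.count_le i t
    rw [countLT_cons] at this
    rw [Function.update_apply]
    -- Below `y.1` nothing is left to close. Above it, for the index of `y`, removing `y` lowers the
    -- left side together with the counter.
    by_cases ht : t ≤ y.1
    · rw [countLT_eq_zero fun z hz => ht.trans (hy.1 z hz)]
      exact Nat.zero_le _
    · split_ifs at this ⊢ <;> subst_vars <;> grind
  count_eq i := by
    have hp := h.count_pos hxy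
    have := h.count_eq i
    rw [countIdx_cons] at this
    rw [Function.update_apply]
    split_ifs at this ⊢ <;> subst_vars <;> grind

theorem sweep_cost_le (cnt : Fin n → ℕ) (active : ℕ) (xs ys : List (ℝ × Fin n)) :
    (sweep cnt active xs ys).cost ≤ 6 * (xs.length + ys.length) + 1 := by
  fun_induction sweep cnt active xs ys with
  | case1 => simp
  | case2 => simp
  | case3 cnt active x xs y ys ih1 ih2 =>
    simp only [Timed.cost_bind, le_val, decide_eq_true_eq, Timed.cost_ite, Timed.cost_pure,
      spend_cost, le_cost, List.length_cons] at *
    split_ifs at * <;> omega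

/-- The strict inequality is the counting form of "some interval of index `i` contains `t`",
relative to the current counters. It transfers back through each step: an opened end has key at most
`t`, a closed end has key less than `t`, so both are counted. -/
theorem sweep_sound {cnt : Fin n → ℕ} {active : ℕ} {xs ys : List (ℝ × Fin n)}
    (ha : active = numActive cnt) (h : SweepInv cnt xs ys) {t : ℝ}
    (ht : (sweep cnt active xs ys).val = some t) :
    (∃ x ∈ xs, x.1 = t) ∧ ∀ i, countLT i t ys < cnt i + countLE i t xs := by
  fun_induction sweep cnt active xs ys with
  | case1 => simp at ht
  | case2 => simp at ht
  | case3 cnt active x xs y ys ih1 ih2 =>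
    subst ha
    simp only [dite_eq_ite] at ih1 ih2
    have hx := List.pairwise_cons.1 h.sorted_xs
    have hy := List.pairwise_cons.1 h.sorted_ys
    simp only [Timed.val_bind, le_val, decide_eq_true_eq, Timed.val_ite, Timed.val_pure] at ht
    rw [numActive_open] at ht ih1
    by_cases h1 : x.1 ≤ y.1
    on_goal 1 => rw [if_pos h1] at ht
    on_goal 1 => by_cases h2 : numActive (Function.update cnt x.2 (cnt x.2 + 1)) = n
    on_goal 1 => rw [if_pos h2] at ht
    on_goal 2 => rw [if_neg h2] at ht
    on_goal 3 => rw [if_neg h1] at ht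
    · obtain rfl : x.1 = t := by simpa using ht
      refine ⟨⟨x, by simp, rfl⟩, fun i => ?_⟩
      -- Ties open before they close, so no remaining upper end precedes `x.1`; positivity of all
      -- counters then suffices.
      rw [countLT_eq_zero (by simpa [h1] using fun a b hab => h1.trans (hy.1 _ hab)),
        countLE_cons]
      have := numActive_eq_iff.1 h2 i
      rw [Function.update_apply] at this
      split_ifs at * <;> grind
    · obtain ⟨⟨z, hz, rfl⟩, hi⟩ := ih1 rfl h.opened ht
      refine ⟨⟨z, by simp [hz], rfl⟩, fun i => ?_⟩
      have := hi i
      have hxz := hx.1 z hz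
      rw [Function.update_apply] at this
      rw [countLE_cons]
      split_ifs at * <;> subst_vars <;> grind
    · have h1 := not_le.1 h1
      have hp := h.count_pos h1
      rw [numActive_close _ _ hp] at ht ih2
      obtain ⟨⟨z, hz, rfl⟩, hi⟩ := ih2 rfl (h.closed h1) ht
      refine ⟨⟨z, hz, rfl⟩, fun i => ?_⟩
      have := hi i
      have hxz : x.1 ≤ z.1 := by
        rcases List.mem_cons.1 hz with rfl | hz
        · exact le_rfl
        · exact hx.1 z hz
      rw [Function.update_apply] at this
      rw [countLT_cons]
      split_ifs at * <;> subst_vars <;> grind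

/-- The counting criterion at `t` is preserved by every step, because the next lower end is at most
`t`. The sweep cannot run past `t`: once no lower end up to `t` is left, the criterion makes every
counter positive. -/
theorem sweep_complete {cnt : Fin n → ℕ} {active : ℕ} {xs ys : List (ℝ × Fin n)}
    (ha : active = numActive cnt) (h : SweepInv cnt xs ys) {t : ℝ}
    (hxt : ∃ x ∈ xs, x.1 ≤ t) (ht : ∀ i, countLT i t ys < cnt i + countLE i t xs) :
    (sweep cnt active xs ys).val ≠ none := by
  fun_induction sweep cnt active xs ys with
  | case1 => simp at hxt
  | case2 cnt active x xs =>
    -- An unopened interval must still have its upper end ahead, so the upper ends cannot run out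
    -- first.
    have := h.count_eq x.2
    simp [countIdx_cons] at this
    simp [countIdx] at this
  | case3 cnt active x xs y ys ih1 ih2 =>
    subst ha
    simp only [dite_eq_ite] at ih1 ih2
    have hx := List.pairwise_cons.1 h.sorted_xs
    have hy := List.pairwise_cons.1 h.sorted_ys
    have hxt' : x.1 ≤ t := by
      obtain ⟨z, hz, hzt⟩ := hxt
      rcases List.mem_cons.1 hz with rfl | hz
      · exact hzt
      · exact (hx.1 z hz).trans hzt
    simp only [Timed.val_bind, le_val, decide_eq_true_eq, Timed.val_ite, Timed.val_pure]
    rw [numActive_open] at ih1 ⊢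
    have ht' : ∀ i, countLT i t (y :: ys) <
        Function.update cnt x.2 (cnt x.2 + 1) i + countLE i t xs := by
      intro i
      have := ht i
      rw [countLE_cons] at this
      rw [Function.update_apply]
      split_ifs at * <;> subst_vars <;> grind
    by_cases h1 : x.1 ≤ y.1
    on_goal 1 => rw [if_pos h1]
    on_goal 1 => by_cases h2 : numActive (Function.update cnt x.2 (cnt x.2 + 1)) = n
    on_goal 1 => rw [if_pos h2]
    on_goal 2 => rw [if_neg h2]
    on_goal 3 => rw [if_neg h1]
    · simp
    · refine ih1 rfl h.opened ?_ ht'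
      -- If all remaining lower ends exceed `t`, the criterion reads `0 ≤ countLT < cnt i` for all
      -- `i`, so the sweep would have stopped here.
      by_contra! hcon
      refine h2 (numActive_eq_iff.2 fun i => ?_)
      have := ht' i
      rw [countLE_eq_zero hcon] at this
      omega
    · have h1 := not_le.1 h1
      have hp := h.count_pos h1
      rw [numActive_close _ _ hp] at ih2 ⊢
      refine ih2 rfl (h.closed h1) hxt fun i => ?_
      have := ht i
      rw [countLT_cons] at this
      rw [Function.update_apply]
      split_ifs at * <;> subst_vars <;> grind

theorem countP_lt_countP {α : Type} {p q : α → Bool} {l : List α} {a : α} (ha : a ∈ l)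
    (hpq : ∀ x ∈ l, p x → q x) (hp : p a = false) (hq : q a) : l.countP p < l.countP q := by
  induction l with
  | nil => simp at ha
  | cons b l ih =>
    simp only [List.mem_cons, forall_eq_or_imp] at hpq
    rw [List.countP_cons, List.countP_cons]
    rcases List.mem_cons.1 ha with rfl | ha
    · have := List.countP_mono_left hpq.2
      simp [hp, hq]
      omega
    · have := ih ha hpq.2
      have := hpq.1
      split_ifs <;> grind

/-- The sweep over the sorted ends of a list of intervals finds a point that lies in an interval of
every index, if there is one. -/
theorem sweep_intervals (Is : List (ℝ × ℝ × Fin n)) (hI : ∀ I ∈ Is, I.1 ≤ I.2.1)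
    {xs ys : List (ℝ × Fin n)} (hx : SortedByKey xs) (hy : SortedByKey ys)
    (hxp : xs.Perm (Is.map fun I => (I.1, I.2.2)))
    (hyp : ys.Perm (Is.map fun I => (I.2.1, I.2.2))) :
    (∀ t, (sweep (fun _ => 0) 0 xs ys).val = some t →
      ∀ i, ∃ I ∈ Is, I.2.2 = i ∧ I.1 ≤ t ∧ t ≤ I.2.1) ∧
    (0 < n → (sweep (fun _ => 0) 0 xs ys).val = none →
      ∀ t, ∃ i, ∀ I ∈ Is, I.2.2 = i → I.1 ≤ t → I.2.1 < t) := by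
  have hLT : ∀ i t, countLT i t ys = Is.countP fun I => I.2.2 = i ∧ I.2.1 < t := fun i t => by
    rw [countLT, hyp.countP_eq, List.countP_map]; rfl
  have hLE : ∀ i t, countLE i t xs = Is.countP fun I => I.2.2 = i ∧ I.1 ≤ t := fun i t => by
    rw [countLE, hxp.countP_eq, List.countP_map]; rfl
  have ha : 0 = numActive fun _ : Fin n => 0 := by simp [numActive]
  have hinv : SweepInv (fun _ => 0) xs ys := by
    refine ⟨hx, hy, fun i t => ?_, fun i => ?_⟩
    · rw [hLT, countLT, hxp.countP_eq, List.countP_map, Nat.zero_add]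
      refine List.countP_mono_left fun I hIm hh => ?_
      simp only [decide_eq_true_eq, Function.comp] at hh ⊢
      exact ⟨hh.1, (hI I hIm).trans_lt hh.2⟩
    · rw [countIdx, countIdx, hyp.countP_eq, hxp.countP_eq, List.countP_map, List.countP_map,
        Nat.zero_add]
      rfl
  refine ⟨fun t ht i => ?_, fun hn hnone t => ?_⟩
  · have := (sweep_sound ha hinv ht).2 i
    rw [hLT, hLE, Nat.zero_add] at this
    by_contra! hcon
    -- If no interval of index `i` contains `t`, every one with lower end at most `t` has its upper
    -- end before `t`, contradicting the strict count.
    refine this.not_ge (List.countP_mono_left fun I hIm hh => ?_)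
    simp only [decide_eq_true_eq] at hh ⊢
    exact ⟨hh.1, hcon I hIm hh.1 hh.2⟩
  · by_contra! hcon
    refine sweep_complete ha hinv (t := t) ?_ (fun i => ?_) hnone
    · obtain ⟨I, hIm, -, h1, -⟩ := hcon ⟨0, hn⟩
      exact ⟨(I.1, I.2.2), hxp.mem_iff.2 (List.mem_map.2 ⟨I, hIm, rfl⟩), h1⟩
    · obtain ⟨I, hIm, hIi, h1, h2⟩ := hcon i
      rw [hLT, hLE, Nat.zero_add]
      refine countP_lt_countP hIm (fun J hJ hh => ?_) ?_ ?_
      · simp only [decide_eq_true_eq] at hh ⊢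
        exact ⟨hh.1, (hI J hJ).trans hh.2.le⟩
      · simpa using fun _ => h2
      · simpa using ⟨hIi, h1⟩

end Sweep

/-! ### Constant-time geometry -/

section Geometry

@[simp] theorem vadd_val (a b : Point) : (vadd a b).val = a + b := by
  ext i; fin_cases i <;> simp [vadd]
@[simp] theorem vadd_cost (a b : Point) : (vadd a b).cost = 2 := by simp [vadd]
@[simp] theorem vsub_val (a b : Point) : (vsub a b).val = a - b := by
  ext i; fin_cases i <;> simp [vsub]
@[simp] theorem vsub_cost (a b : Point) : (vsub a b).cost = 2 := by simp [vsub]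
@[simp] theorem smul_val (t : ℝ) (a : Point) : (smul t a).val = t • a := by
  ext i; fin_cases i <;> simp [smul]
@[simp] theorem smul_cost (t : ℝ) (a : Point) : (smul t a).cost = 2 := by simp [smul]
@[simp] theorem dot_val (a b : Point) : (dot a b).val = a 0 * b 0 + a 1 * b 1 := by simp [dot]
@[simp] theorem dot_cost (a b : Point) : (dot a b).cost = 3 := by simp [dot]
@[simp] theorem cross_val (a b : Point) : (cross a b).val = a 0 * b 1 - a 1 * b 0 := by simp [cross]
@[simp] theorem cross_cost (a b : Point) : (cross a b).cost = 3 := by simp [cross]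

theorem point_dist_eq (a b : Point) :
    dist a b = √((a 0 - b 0) ^ 2 + (a 1 - b 1) ^ 2) := by
  simp [EuclideanSpace.dist_eq, Fin.sum_univ_two, Real.dist_eq]

theorem point_dist_le_iff {a b : Point} {r : ℝ} (hr : 0 ≤ r) :
    dist a b ≤ r ↔ (a 0 - b 0) ^ 2 + (a 1 - b 1) ^ 2 ≤ r ^ 2 := by
  rw [point_dist_eq, Real.sqrt_le_left hr]

@[simp] theorem distance_val (a b : Point) : (distance a b).val = dist a b := by
  simp [distance, point_dist_eq, sq]
@[simp] theorem distance_cost (a b : Point) : (distance a b).cost = 6 := by simp [distance]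

/-- The optional closed interval `o` is nonempty and consists of the points that satisfy `P`. -/
structure IsIntervalOf (o : Option (ℝ × ℝ)) (P : ℝ → Prop) : Prop where
  le : ∀ I ∈ o, I.1 ≤ I.2
  mem_iff : ∀ t, (∃ I ∈ o, I.1 ≤ t ∧ t ≤ I.2) ↔ P t

theorem IsIntervalOf.none {P : ℝ → Prop} (h : ∀ t, ¬ P t) : IsIntervalOf none P :=
  ⟨by simp, fun t => by simp [h t]⟩

theorem IsIntervalOf.some {P : ℝ → Prop} {I : ℝ × ℝ} (hI : I.1 ≤ I.2)
    (h : ∀ t, I.1 ≤ t ∧ t ≤ I.2 ↔ P t) : IsIntervalOf (some I) P :=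
  ⟨by simpa using hI, fun t => by simp [← h t]⟩

theorem IsIntervalOf.congr {o : Option (ℝ × ℝ)} {P Q : ℝ → Prop} (h : IsIntervalOf o P)
    (hPQ : ∀ t, P t ↔ Q t) : IsIntervalOf o Q :=
  ⟨h.le, fun t => (h.mem_iff t).trans (hPQ t)⟩

theorem meet_spec (I J : ℝ × ℝ) :
    IsIntervalOf (meet I J).val fun t => (I.1 ≤ t ∧ t ≤ I.2) ∧ J.1 ≤ t ∧ t ≤ J.2 := by
  have h : (meet I J).val =
      if max I.1 J.1 ≤ min I.2 J.2 then some (max I.1 J.1, min I.2 J.2) else none := by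
    simp [meet, max_def, min_def]
  rw [h]
  split_ifs with h'
  · refine .some h' fun t => ?_
    simp only [max_le_iff, le_min_iff]
    tauto
  · refine .none fun t ⟨⟨h1, h2⟩, h3, h4⟩ => h' ?_
    exact (max_le h1 h3).trans (le_min h2 h4)

theorem meet_cost_le (I J : ℝ × ℝ) : (meet I J).cost ≤ 3 := by
  simp [meet]

theorem clip_spec (lo hi α β : ℝ) {I : ℝ × ℝ} (hI : I.1 ≤ I.2) :
    IsIntervalOf (clip lo hi α β I).val
      fun t => (lo ≤ α + β * t ∧ α + β * t ≤ hi) ∧ I.1 ≤ t ∧ t ≤ I.2 := by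
  simp only [clip, Timed.val_bind, sub_val, lt_val, le_val, div_val, decide_eq_true_eq,
    Timed.val_ite, Timed.val_pure]
  split_ifs with h1 h2 h3 h4
  · refine (meet_spec _ _).congr fun t => and_congr_left fun _ => ?_
    rw [div_le_iff₀ h1, le_div_iff₀ h1]
    constructor <;> rintro ⟨_, _⟩ <;> constructor <;> linarith
  · refine (meet_spec _ _).congr fun t => and_congr_left fun _ => ?_
    rw [div_le_iff_of_neg h2, le_div_iff_of_neg h2]
    constructor <;> rintro ⟨_, _⟩ <;> constructor <;> linarith
  · obtain rfl : β = 0 := le_antisymm (not_lt.1 h1) (not_lt.1 h2)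
    refine .some hI fun t => ?_
    refine ⟨fun h => ⟨⟨?_, ?_⟩, h⟩, fun h => h.2⟩ <;> linarith
  · obtain rfl : β = 0 := le_antisymm (not_lt.1 h1) (not_lt.1 h2)
    refine .none fun t ⟨⟨_, _⟩, _⟩ => h4 ?_
    linarith
  · obtain rfl : β = 0 := le_antisymm (not_lt.1 h1) (not_lt.1 h2)
    refine .none fun t ⟨⟨_, _⟩, _⟩ => h3 ?_
    linarith

theorem clip_cost_le (lo hi α β : ℝ) (I : ℝ × ℝ) : (clip lo hi α β I).cost ≤ 9 := by
  simp only [clip, Timed.cost_bind, sub_val, lt_val, le_val, div_val,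
    decide_eq_true_eq, Timed.cost_ite, Timed.cost_pure, sub_cost, lt_cost, le_cost, div_cost]
  have h1 := meet_cost_le ((lo - α) / β, (hi - α) / β) I
  have h2 := meet_cost_le ((hi - α) / β, (lo - α) / β) I
  split_ifs <;> omega

theorem diskInterval_spec (a d c : Point) {τ : ℝ} (hτ : 0 ≤ τ) :
    IsIntervalOf (diskInterval a d c τ).val
      fun t => (0 ≤ t ∧ t ≤ 1) ∧ dist (a + t • d) c ≤ τ := by
  simp only [diskInterval, Timed.val_bind, vsub_val, dot_val, mul_val, sub_val, lt_val, le_val,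
    div_val, add_val, sqrt_val, decide_eq_true_eq, Timed.val_ite, Timed.val_pure, PiLp.sub_apply,
    point_dist_le_iff hτ, PiLp.add_apply, PiLp.smul_apply, smul_eq_mul]
  set A := d 0 * d 0 + d 1 * d 1 with hA
  set B := d 0 * (a 0 - c 0) + d 1 * (a 1 - c 1) with hB
  set C := (a 0 - c 0) * (a 0 - c 0) + (a 1 - c 1) * (a 1 - c 1) - τ * τ with hC
  have hq : ∀ t, (a 0 + t * d 0 - c 0) ^ 2 + (a 1 + t * d 1 - c 1) ^ 2 - τ ^ 2 =
      A * t ^ 2 + 2 * B * t + C := fun t => by rw [hA, hB, hC]; ring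
  have hP : ∀ t, (a 0 + t * d 0 - c 0) ^ 2 + (a 1 + t * d 1 - c 1) ^ 2 ≤ τ ^ 2 ↔
      A * t ^ 2 + 2 * B * t + C ≤ 0 := fun t => by rw [← hq, sub_nonpos]
  simp only [hP]
  split_ifs with h1 h2 h3
  · refine (meet_spec _ _).congr fun t => and_comm.trans (and_congr_right fun _ => ?_)
    rw [div_le_iff₀ h1, le_div_iff₀ h1]
    -- Multiplying by `A > 0` and completing the square turns the condition into `|A * t + B| ≤ √D`.
    have hs : A * (A * t ^ 2 + 2 * B * t + C) = (A * t + B) ^ 2 - (B * B - A * C) := by ring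
    have hk : A * t ^ 2 + 2 * B * t + C ≤ 0 ↔ (A * t + B) ^ 2 ≤ B * B - A * C := by
      rw [← sub_nonpos (b := B * B - A * C), ← hs]
      exact (mul_nonpos_iff_pos_imp_nonpos.trans ⟨fun h => h.1 h1, fun h =>
        ⟨fun _ => h, fun h' => h1.le⟩⟩).symm
    rw [hk, Real.sq_le h2]
    constructor <;> rintro ⟨_, _⟩ <;> constructor <;> linarith
  · refine .none fun t ⟨_, ht⟩ => h2 ?_
    nlinarith [sq_nonneg (A * t + B)]
  · have h0 : d 0 = 0 := by nlinarith [sq_nonneg (d 0), sq_nonneg (d 1)]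
    have h0' : d 1 = 0 := by nlinarith [sq_nonneg (d 0), sq_nonneg (d 1)]
    have hA0 : A = 0 := by simp [hA, h0, h0']
    have hB0 : B = 0 := by simp [hB, h0, h0']
    exact .some zero_le_one fun t => by simp [hA0, hB0, h3]
  · have h0 : d 0 = 0 := by nlinarith [sq_nonneg (d 0), sq_nonneg (d 1)]
    have h0' : d 1 = 0 := by nlinarith [sq_nonneg (d 0), sq_nonneg (d 1)]
    have hA0 : A = 0 := by simp [hA, h0, h0']
    have hB0 : B = 0 := by simp [hB, h0, h0']
    exact .none fun t => by simpa [hA0, hB0] using fun _ _ => not_le.1 h3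

theorem diskInterval_cost_le (a d c : Point) (τ : ℝ) : (diskInterval a d c τ).cost ≤ 30 := by
  simp only [diskInterval, Timed.cost_bind, vsub_val, dot_val, mul_val, sub_val,
    lt_val, le_val, div_val, add_val, sqrt_val, decide_eq_true_eq, Timed.cost_ite, Timed.cost_pure,
    vsub_cost, dot_cost, mul_cost, sub_cost, lt_cost, le_cost, div_cost, add_cost, sqrt_cost]
  split_ifs
  · grw [meet_cost_le]
    norm_num
  all_goals norm_num

theorem slabInterval_spec (a d : Point) (s : Seg) (τ : ℝ) :
    IsIntervalOf (slabInterval a d s τ).val fun t =>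
      0 < (s.q 0 - s.p 0) ^ 2 + (s.q 1 - s.p 1) ^ 2 ∧ (0 ≤ t ∧ t ≤ 1) ∧
      (0 ≤ (s.q 0 - s.p 0) * ((a + t • d) 0 - s.p 0) + (s.q 1 - s.p 1) * ((a + t • d) 1 - s.p 1) ∧
        (s.q 0 - s.p 0) * ((a + t • d) 0 - s.p 0) + (s.q 1 - s.p 1) * ((a + t • d) 1 - s.p 1) ≤
          (s.q 0 - s.p 0) ^ 2 + (s.q 1 - s.p 1) ^ 2) ∧
      |(s.q 0 - s.p 0) * ((a + t • d) 1 - s.p 1) - (s.q 1 - s.p 1) * ((a + t • d) 0 - s.p 0)| ≤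
        τ * √((s.q 0 - s.p 0) ^ 2 + (s.q 1 - s.p 1) ^ 2) := by
  simp only [slabInterval, Timed.val_bind, vsub_val, dot_val, lt_val, decide_eq_true_eq,
    Timed.val_ite, Timed.val_pure, PiLp.sub_apply, PiLp.add_apply,
    PiLp.smul_apply, smul_eq_mul, ← sq]
  set e0 := s.q 0 - s.p 0
  set e1 := s.q 1 - s.p 1
  set L := e0 ^ 2 + e1 ^ 2
  split_ifs with h1
  · have hc := clip_spec 0 L (e0 * (a 0 - s.p 0) + e1 * (a 1 - s.p 1)) (e0 * d 0 + e1 * d 1)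
      (I := (0, 1)) zero_le_one
    generalize (clip 0 L (e0 * (a 0 - s.p 0) + e1 * (a 1 - s.p 1)) (e0 * d 0 + e1 * d 1)
      (0, 1)).val = o at hc
    have hα : ∀ t, e0 * (a 0 - s.p 0) + e1 * (a 1 - s.p 1) + (e0 * d 0 + e1 * d 1) * t =
      e0 * (a 0 + t * d 0 - s.p 0) + e1 * (a 1 + t * d 1 - s.p 1) := fun t => by ring
    simp only [hα] at hc
    cases o with
    | none =>
      refine .none fun t ht => ?_
      have := (hc.mem_iff t).2 ⟨ht.2.2.1, ht.2.1⟩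
      simp at this
    | some J =>
      refine (clip_spec _ _ _ _ (hc.le J rfl)).congr fun t => ?_
      simp only [cross_val, mul_val, sub_val, sqrt_val, PiLp.sub_apply]
      have hJ := hc.mem_iff t
      simp only [Option.mem_def, Option.some.injEq, exists_eq_left'] at hJ
      rw [hJ, abs_le]
      have hβ : e0 * (a 1 - s.p 1) - e1 * (a 0 - s.p 0) + (e0 * d 1 - e1 * d 0) * t =
        e0 * (a 1 + t * d 1 - s.p 1) - e1 * (a 0 + t * d 0 - s.p 0) := by ring
      simp only [hβ, zero_sub, L, e0, e1] at *
      tauto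
  · exact .none fun t ht => h1 ht.1

theorem slabInterval_cost_le (a d : Point) (s : Seg) (τ : ℝ) :
    (slabInterval a d s τ).cost ≤ 50 := by
  simp only [slabInterval, Timed.cost_bind, vsub_val, dot_val, lt_val, decide_eq_true_eq,
    Timed.cost_ite, Timed.cost_pure, vsub_cost, dot_cost, lt_cost]
  split_ifs
  · have h1 := clip_cost_le 0
      ((s.q - s.p) 0 * (s.q - s.p) 0 + (s.q - s.p) 1 * (s.q - s.p) 1)
      ((s.q - s.p) 0 * (a - s.p) 0 + (s.q - s.p) 1 * (a - s.p) 1)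
      ((s.q - s.p) 0 * d 0 + (s.q - s.p) 1 * d 1) (0, 1)
    split
    · simp only [Timed.cost_pure]
      omega
    · simp only [Timed.cost_bind, sqrt_cost, mul_cost, sub_cost, cross_cost]
      grw [h1, clip_cost_le]
      norm_num
  · norm_num

/-! ### Distance to a segment as a union of two disks and a rectangle. -/

theorem isCompact_points (s : Seg) : IsCompact s.points := by
  rw [Seg.points, segment_eq_image']
  exact isCompact_Icc.image (by fun_prop)

theorem points_nonempty (s : Seg) : s.points.Nonempty := ⟨s.p, left_mem_segment ℝ _ _⟩

theorem infDist_le_iff_exists {K : Set Point} (hK : IsCompact K) (hne : K.Nonempty) {z : Point}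
    {r : ℝ} : Metric.infDist z K ≤ r ↔ ∃ y ∈ K, dist z y ≤ r := by
  constructor
  · intro h
    obtain ⟨y, hy, hd⟩ := hK.exists_infDist_eq_dist hne z
    exact ⟨y, hy, hd ▸ h⟩
  · rintro ⟨y, hy, hd⟩
    exact (Metric.infDist_le_dist_of_mem hy).trans hd

theorem infDist_points_le_iff (s : Seg) (z : Point) {τ : ℝ} (hτ : 0 ≤ τ) :
    Metric.infDist z s.points ≤ τ ↔ dist z s.p ≤ τ ∨ dist z s.q ≤ τ ∨
      (0 < (s.q 0 - s.p 0) ^ 2 + (s.q 1 - s.p 1) ^ 2 ∧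
      (0 ≤ (s.q 0 - s.p 0) * (z 0 - s.p 0) + (s.q 1 - s.p 1) * (z 1 - s.p 1) ∧
        (s.q 0 - s.p 0) * (z 0 - s.p 0) + (s.q 1 - s.p 1) * (z 1 - s.p 1) ≤
          (s.q 0 - s.p 0) ^ 2 + (s.q 1 - s.p 1) ^ 2) ∧
      |(s.q 0 - s.p 0) * (z 1 - s.p 1) - (s.q 1 - s.p 1) * (z 0 - s.p 0)| ≤
        τ * √((s.q 0 - s.p 0) ^ 2 + (s.q 1 - s.p 1) ^ 2)) := by
  rw [infDist_le_iff_exists (isCompact_points s) (points_nonempty s), Seg.points,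
    segment_eq_image']
  simp only [Set.mem_image, exists_exists_and_eq_and, point_dist_le_iff hτ, Set.mem_Icc,
    PiLp.add_apply, PiLp.smul_apply, PiLp.sub_apply, smul_eq_mul]
  obtain ⟨e0, he0⟩ : ∃ e0, s.q 0 = s.p 0 + e0 := ⟨_, (add_sub_cancel _ _).symm⟩
  obtain ⟨e1, he1⟩ : ∃ e1, s.q 1 = s.p 1 + e1 := ⟨_, (add_sub_cancel _ _).symm⟩
  obtain ⟨w0, hw0⟩ : ∃ w0, z 0 = s.p 0 + w0 := ⟨_, (add_sub_cancel _ _).symm⟩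
  obtain ⟨w1, hw1⟩ : ∃ w1, z 1 = s.p 1 + w1 := ⟨_, (add_sub_cancel _ _).symm⟩
  rw [he0, he1, hw0, hw1]
  simp only [add_sub_cancel_left, add_sub_add_left_eq_sub]
  set L := e0 ^ 2 + e1 ^ 2 with hL
  have hL0 : 0 ≤ L := by positivity
  have habs : |e0 * w1 - e1 * w0| ≤ τ * √L ↔ (e0 * w1 - e1 * w0) ^ 2 ≤ τ ^ 2 * L := by
    have : τ * √L = √(τ ^ 2 * L) := by rw [Real.sqrt_mul (sq_nonneg τ), Real.sqrt_sq hτ]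
    rw [this, Real.le_sqrt (abs_nonneg _) (by positivity), sq_abs]
  rw [habs]
  have hlag : (e0 * w1 - e1 * w0) ^ 2 + (e0 * w0 + e1 * w1) ^ 2 = L * (w0 ^ 2 + w1 ^ 2) := by
    rw [hL]; ring
  constructor
  · rintro ⟨θ, ⟨hθ0, hθ1⟩, hθ⟩
    have key : (e0 * w1 - e1 * w0) ^ 2 + (e0 * w0 + e1 * w1 - θ * L) ^ 2 =
        L * ((w0 - θ * e0) ^ 2 + (w1 - θ * e1) ^ 2) := by rw [hL]; ring
    have hd : (w0 - θ * e0) ^ 2 + (w1 - θ * e1) ^ 2 =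
        w0 ^ 2 + w1 ^ 2 - 2 * θ * (e0 * w0 + e1 * w1) + θ ^ 2 * L := by rw [hL]; ring
    have h2 := hθ
    rw [hd] at hθ
    -- If the projection falls before `s.p` or beyond `s.q`, that end is at least as close to `z` as
    -- the given point; otherwise `key` bounds the distance to the line. A degenerate segment is
    -- covered by the disk at `s.p`.
    rcases lt_or_ge (e0 * w0 + e1 * w1) 0 with h0 | h0
    · left
      nlinarith [mul_nonneg hθ0 (neg_pos.2 h0).le, mul_nonneg (sq_nonneg θ) hL0]
    rcases lt_or_ge L (e0 * w0 + e1 * w1) with h1 | h1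
    · right; left
      nlinarith [mul_nonneg (sub_nonneg.2 hθ1) (sub_pos.2 h1).le,
        mul_nonneg (sq_nonneg (1 - θ)) hL0]
    rcases hL0.eq_or_lt with hz | hp
    · left
      have : e0 * w0 + e1 * w1 = 0 := by linarith
      rw [this, ← hz] at hθ
      linarith
    · right; right
      refine ⟨hp, ⟨h0, h1⟩, ?_⟩
      nlinarith [mul_le_mul_of_nonneg_left h2 hL0, sq_nonneg (e0 * w0 + e1 * w1 - θ * L)]
  · rintro (h | h | ⟨hp, ⟨h0, h1⟩, h2⟩)
    · exact ⟨0, ⟨le_rfl, zero_le_one⟩, by simpa using h⟩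
    · refine ⟨1, ⟨zero_le_one, le_rfl⟩, le_trans (le_of_eq ?_) h⟩
      ring
    -- The witness is the foot of the perpendicular; `L` times its squared distance is the squared
    -- cross product.
    · refine ⟨(e0 * w0 + e1 * w1) / L, ⟨by positivity, (div_le_one hp).2 h1⟩, ?_⟩
      rw [← mul_le_mul_iff_right₀ hp]
      refine le_trans (le_of_eq ?_) (h2.trans (le_of_eq (mul_comm _ _)))
      field_simp
      rw [hL]
      ring

theorem nearIntervals_val (a d : Point) (τ : ℝ) (s : Seg) :
    (nearIntervals a d τ s).val = (diskInterval a d s.p τ).val.toList ++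
      (diskInterval a d s.q τ).val.toList ++ (slabInterval a d s τ).val.toList := by
  simp [nearIntervals]

theorem nearIntervals_le {a d : Point} {τ : ℝ} (hτ : 0 ≤ τ) {s : Seg} :
    ∀ I ∈ (nearIntervals a d τ s).val, I.1 ≤ I.2 := by
  intro I hI
  rw [nearIntervals_val] at hI
  simp only [List.mem_append, Option.mem_toList] at hI
  rcases hI with (hI | hI) | hI
  · exact (diskInterval_spec a d s.p hτ).le I hI
  · exact (diskInterval_spec a d s.q hτ).le I hI
  · exact (slabInterval_spec a d s τ).le I hI

theorem mem_nearIntervals_iff {a d : Point} {τ : ℝ} (hτ : 0 ≤ τ) {s : Seg} {t : ℝ} :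
    (∃ I ∈ (nearIntervals a d τ s).val, I.1 ≤ t ∧ t ≤ I.2) ↔
      (0 ≤ t ∧ t ≤ 1) ∧ Metric.infDist (a + t • d) s.points ≤ τ := by
  have h1 := (diskInterval_spec a d s.p hτ).mem_iff t
  have h2 := (diskInterval_spec a d s.q hτ).mem_iff t
  have h3 := (slabInterval_spec a d s τ).mem_iff t
  have h : (∃ I ∈ (nearIntervals a d τ s).val, I.1 ≤ t ∧ t ≤ I.2) ↔
      ((∃ I ∈ (diskInterval a d s.p τ).val, I.1 ≤ t ∧ t ≤ I.2) ∨
        (∃ I ∈ (diskInterval a d s.q τ).val, I.1 ≤ t ∧ t ≤ I.2)) ∨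
        ∃ I ∈ (slabInterval a d s τ).val, I.1 ≤ t ∧ t ≤ I.2 := by
    rw [nearIntervals_val]
    simp only [List.mem_append, Option.mem_toList, Option.mem_def, or_and_right, exists_or]
  rw [h, h1, h2, h3, infDist_points_le_iff s _ hτ, and_or_left, and_or_left, or_assoc]
  exact or_congr .rfl (or_congr .rfl and_left_comm)

theorem length_nearIntervals_le (a d : Point) (τ : ℝ) (s : Seg) :
    (nearIntervals a d τ s).val.length ≤ 3 := by
  rw [nearIntervals_val]
  simp only [List.length_append, Option.length_toList]
  grind

theorem nearIntervals_cost_le (a d : Point) (τ : ℝ) (s : Seg) :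
    (nearIntervals a d τ s).cost ≤ 113 := by
  have h1 := diskInterval_cost_le a d s.p τ
  have h2 := diskInterval_cost_le a d s.q τ
  have h3 := slabInterval_cost_le a d s τ
  simp only [nearIntervals, Timed.cost_bind, spend_cost, Timed.cost_pure]
  omega

end Geometry

/-! ### Feasible points of a segment -/

section Feasible

variable {n k : ℕ}

/-- The list of the segments of a trajectory. -/
def segments (T : Trajectory k) : List Seg :=
  List.ofFn fun j : Fin k => ⟨T j.castSucc, T j.succ⟩

/-- Every index of the family with the list of segments of its trajectory. -/
def inputSegments (𝒯 : Fin n → Trajectory k) : List (Fin n × List Seg) :=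
  (List.finRange n).map fun i => (i, segments (𝒯 i))

/-- The point `z` has distance at most `τ` from every trajectory. -/
def Feasible (𝒯 : Fin n → Trajectory k) (τ : ℝ) (z : Point) : Prop :=
  ∀ i, Metric.infDist z (carrier (𝒯 i)) ≤ τ

@[simp] theorem length_segments (T : Trajectory k) : (segments T).length = k := by
  simp [segments]

@[simp] theorem length_inputSegments (𝒯 : Fin n → Trajectory k) :
    (inputSegments 𝒯).length = n := by
  simp [inputSegments]

theorem mem_inputSegments {𝒯 : Fin n → Trajectory k} {S : Fin n × List Seg} :
    S ∈ inputSegments 𝒯 ↔ S.2 = segments (𝒯 S.1) := by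
  simp only [inputSegments, List.mem_map, List.mem_finRange, true_and]
  constructor
  · rintro ⟨i, rfl⟩
    rfl
  · rintro h
    exact ⟨S.1, by rw [← h]⟩

theorem readSegments_val (T : Trajectory k) : (readSegments T).val = segments T := rfl

theorem readSegments_cost (T : Trajectory k) : (readSegments T).cost = k + 1 := rfl

theorem readInput_val (𝒯 : Fin n → Trajectory k) : (readInput 𝒯).val = inputSegments 𝒯 := by
  simp [readInput, inputSegments, readSegments_val]

theorem readInput_cost_le (𝒯 : Fin n → Trajectory k) :
    (readInput 𝒯).cost ≤ (k + 3) * n + 2 := by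
  have := mapList_cost_le (fun i => do
    let S ← readSegments (𝒯 i)
    return (i, S)) (List.finRange n) (k + 1) (fun i _ => by simp [readSegments_cost])
  rw [List.length_finRange] at this
  simp only [readInput, Timed.cost_bind, spend_cost]
  nlinarith

theorem mem_carrier_iff {T : Trajectory k} {z : Point} :
    z ∈ carrier T ↔ ∃ s ∈ segments T, z ∈ s.points := by
  simp only [carrier, Set.mem_iUnion, segments, List.mem_ofFn', Set.mem_range,
    exists_exists_eq_and]
  rfl

theorem isCompact_carrier (T : Trajectory k) : IsCompact (carrier T) :=
  isCompact_iUnion fun j => isCompact_points ⟨T j.castSucc, T j.succ⟩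

theorem start_mem_carrier (hk : 1 ≤ k) (T : Trajectory k) : T 0 ∈ carrier T :=
  Set.mem_iUnion.2 ⟨⟨0, hk⟩, left_mem_segment ℝ _ _⟩

theorem carrier_nonempty (hk : 1 ≤ k) (T : Trajectory k) : (carrier T).Nonempty :=
  ⟨_, start_mem_carrier hk T⟩

theorem infDist_carrier_le_iff (hk : 1 ≤ k) {T : Trajectory k} {z : Point} {τ : ℝ} :
    Metric.infDist z (carrier T) ≤ τ ↔ ∃ s ∈ segments T, Metric.infDist z s.points ≤ τ := by
  rw [infDist_le_iff_exists (isCompact_carrier T) (carrier_nonempty hk T)]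
  simp only [mem_carrier_iff, infDist_le_iff_exists (isCompact_points _) (points_nonempty _)]
  constructor
  · rintro ⟨y, ⟨s, hs, hy⟩, h⟩
    exact ⟨s, hs, y, hy, h⟩
  · rintro ⟨s, hs, y, hy, h⟩
    exact ⟨y, ⟨s, hs, hy⟩, h⟩

theorem mem_allIntervals (𝒯 : Fin n → Trajectory k) (a d : Point) (τ : ℝ)
    (I : ℝ × ℝ × Fin n) : I ∈ (allIntervals (inputSegments 𝒯) a d τ).val ↔
      ∃ s ∈ segments (𝒯 I.2.2), (I.1, I.2.1) ∈ (nearIntervals a d τ s).val := by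
  simp only [allIntervals, Timed.val_bind, mapList_val, flatten_val, List.mem_flatten,
    List.mem_map, exists_exists_and_eq_and, Timed.val_pure, mem_inputSegments]
  constructor
  · rintro ⟨S, hS, J, ⟨s, hs, hJ⟩, rfl⟩
    exact ⟨s, hS ▸ hs, hJ⟩
  · rintro ⟨s, hs, hI⟩
    exact ⟨(I.2.2, segments (𝒯 I.2.2)), rfl, (I.1, I.2.1), ⟨s, hs, hI⟩, rfl⟩

theorem length_allIntervals_le (𝒯 : Fin n → Trajectory k) (a d : Point) (τ : ℝ) :
    (allIntervals (inputSegments 𝒯) a d τ).val.length ≤ 3 * k * n := by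
  simp only [allIntervals, Timed.val_bind, mapList_val, flatten_val, Timed.val_pure]
  refine (length_flatten_le _ (3 * k) ?_).trans (by simp)
  intro l hl
  obtain ⟨S, hS, rfl⟩ := List.mem_map.1 hl
  rw [List.length_map]
  refine (length_flatten_le _ 3 ?_).trans (by simp [mem_inputSegments.1 hS])
  intro l hl
  obtain ⟨s, hs, rfl⟩ := List.mem_map.1 hl
  exact length_nearIntervals_le a d τ s

theorem allIntervals_cost_le (hk : 1 ≤ k) (𝒯 : Fin n → Trajectory k) (a d : Point) (τ : ℝ) :
    (allIntervals (inputSegments 𝒯) a d τ).cost ≤ 134 * (n * k) + 2 := by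
  have hlen := length_allIntervals_le 𝒯 a d τ
  simp only [allIntervals, Timed.val_bind, flatten_val] at hlen
  simp only [allIntervals, Timed.cost_bind, flatten_cost]
  have hmap := mapList_cost_le (fun S : Fin n × List Seg => do
    let Js ← mapList (nearIntervals a d τ) S.2
    let J ← flatten Js
    mapList (fun I : ℝ × ℝ => (do
      spend 1
      return (I.1, I.2, S.1) : Timed (ℝ × ℝ × Fin n))) J) (inputSegments 𝒯) (125 * k + 3) ?_
  · have h1 : (mapList (fun S : Fin n × List Seg => do
        let Js ← mapList (nearIntervals a d τ) S.2
        let J ← flatten Js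
        mapList (fun I : ℝ × ℝ => (do
          spend 1
          return (I.1, I.2, S.1) : Timed (ℝ × ℝ × Fin n))) J) (inputSegments 𝒯)).val.length =
        n := by
      simp
    rw [length_inputSegments] at hmap
    grw [hmap, hlen, h1]
    nlinarith
  · intro S hS
    have hS := congrArg List.length (mem_inputSegments.1 hS)
    rw [length_segments] at hS
    have h1 := mapList_cost_le (nearIntervals a d τ) S.2 113
      fun s _ => nearIntervals_cost_le a d τ s
    have h2 : (mapList (nearIntervals a d τ) S.2).val.flatten.length ≤ 3 * k := by
      refine (length_flatten_le _ 3 ?_).trans (by simp [hS])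
      intro l hl
      rw [mapList_val] at hl
      obtain ⟨s, hs, rfl⟩ := List.mem_map.1 hl
      exact length_nearIntervals_le a d τ s
    have h3 : (mapList (nearIntervals a d τ) S.2).val.length = k := by simp [hS]
    have h4 := mapList_cost_le (fun I : ℝ × ℝ => (do
      spend 1
      return (I.1, I.2, S.1) : Timed (ℝ × ℝ × Fin n)))
      (mapList (nearIntervals a d τ) S.2).val.flatten 1 (fun _ _ => by simp)
    simp only [Timed.cost_bind, flatten_cost, flatten_val]
    rw [hS] at h1
    omega

/-- A bound for the number of steps of one round of EstimateRad. -/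
def roundCost (n k : ℕ) : ℕ := 212 * (n * k) + 18 * (n * k) * Nat.clog 2 (3 * (n * k))

theorem mergeSort_cost_le_of_length_le {α : Type} {l : List (ℝ × α)} {N : ℕ} (h : l.length ≤ N) :
    (mergeSort l).cost ≤ 3 * N * Nat.clog 2 N + 2 * N + 1 := by
  have := Nat.clog_mono_right 2 h
  grw [mergeSort_cost_le, this, h]

/-- The slack of 3 pays for the rest of a round of `estimateRadBody`: its own step, the test against
`ρ` and the division by `γ`. -/
theorem feasiblePoint_cost_le (hn : 1 ≤ n) (hk : 1 ≤ k) (𝒯 : Fin n → Trajectory k) (s : Seg)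
    (τ : ℝ) : (feasiblePoint (inputSegments 𝒯) s τ).cost + 3 ≤ roundCost n k := by
  simp only [feasiblePoint, Timed.cost_bind, vsub_val, vsub_cost]
  have h1 := allIntervals_cost_le hk 𝒯 s.p (s.q - s.p) τ
  have hlen := length_allIntervals_le 𝒯 s.p (s.q - s.p) τ
  generalize allIntervals (inputSegments 𝒯) s.p (s.q - s.p) τ = Is at *
  have h2 := mapList_cost_le (fun I : ℝ × ℝ × Fin n => (do
    spend 1
    return (I.1, I.2.2) : Timed (ℝ × Fin n))) Is.val 1 (fun _ _ => by simp)
  have h3 := mapList_cost_le (fun I : ℝ × ℝ × Fin n => (do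
    spend 1
    return (I.2.1, I.2.2) : Timed (ℝ × Fin n))) Is.val 1 (fun _ _ => by simp)
  have l2 : (mapList (fun I : ℝ × ℝ × Fin n => (do
    spend 1
    return (I.1, I.2.2) : Timed (ℝ × Fin n))) Is.val).val.length ≤ 3 * k * n := by simpa
  have l3 : (mapList (fun I : ℝ × ℝ × Fin n => (do
    spend 1
    return (I.2.1, I.2.2) : Timed (ℝ × Fin n))) Is.val).val.length ≤ 3 * k * n := by simpa
  generalize mapList _ Is.val = los at *
  generalize mapList _ Is.val = his at *
  have h4 := mergeSort_cost_le_of_length_le l2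
  have h5 := mergeSort_cost_le_of_length_le l3
  have h6 := sweep_cost_le (fun _ : Fin n => 0) 0 (mergeSort los.val).val (mergeSort his.val).val
  rw [(mergeSort_perm _).length_eq, (mergeSort_perm _).length_eq] at h6
  -- Besides the logarithmic part, the steps and the slack add up to at most `195 * (n * k) + 17`;
  -- the constant is absorbed by `1 ≤ n * k`, giving 212.
  have hnk : 1 ≤ n * k := Nat.mul_pos hn hk
  have hn' : n ≤ n * k := Nat.le_mul_of_pos_right n hk
  have h7 : 3 * k * n = 3 * (n * k) := by ring
  rw [h7] at hlen l2 l3 h4 h5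
  have h8 : 3 * (3 * (n * k)) * Nat.clog 2 (3 * (n * k)) =
    9 * ((n * k) * Nat.clog 2 (3 * (n * k))) := by ring
  have h9 : 18 * (n * k) * Nat.clog 2 (3 * (n * k)) =
    18 * ((n * k) * Nat.clog 2 (3 * (n * k))) := by ring
  rw [h8] at h4 h5
  rw [roundCost, h9, spend_cost]
  generalize sweep _ _ _ _ = w at *
  obtain ⟨_ | t, c⟩ := w
  · simp only [Timed.cost_pure] at *
    omega
  · simp only [Timed.cost_pure, Timed.cost_bind, smul_cost, vadd_cost] at *
    omega

theorem feasiblePoint_spec (hn : 1 ≤ n) (hk : 1 ≤ k) (𝒯 : Fin n → Trajectory k) (s : Seg)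
    {τ : ℝ} (hτ : 0 ≤ τ) :
    (∀ c, (feasiblePoint (inputSegments 𝒯) s τ).val = some c → Feasible 𝒯 τ c) ∧
    ((feasiblePoint (inputSegments 𝒯) s τ).val = none → ∀ z ∈ s.points, ¬ Feasible 𝒯 τ z) := by
  have hmem := mem_allIntervals 𝒯 s.p (s.q - s.p) τ
  simp only [feasiblePoint, Timed.val_bind, vsub_val]
  generalize allIntervals (inputSegments 𝒯) s.p (s.q - s.p) τ = Is at *
  have hle : ∀ I ∈ Is.val, I.1 ≤ I.2.1 := by
    intro I hI
    obtain ⟨s', -, h⟩ := (hmem I).1 hI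
    exact nearIntervals_le hτ _ h
  have hfeas : ∀ t, (0 ≤ t ∧ t ≤ 1) → (Feasible 𝒯 τ (s.p + t • (s.q - s.p)) ↔
      ∀ i, ∃ I ∈ Is.val, I.2.2 = i ∧ I.1 ≤ t ∧ t ≤ I.2.1) := by
    intro t ht
    refine forall_congr' fun i => ?_
    rw [infDist_carrier_le_iff hk]
    constructor
    · rintro ⟨s', hs', hd⟩
      obtain ⟨J, hJ, hJt⟩ := (mem_nearIntervals_iff hτ).2 ⟨ht, hd⟩
      exact ⟨(J.1, J.2, i), (hmem _).2 ⟨s', hs', hJ⟩, rfl, hJt⟩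
    · rintro ⟨I, hI, rfl, hIt⟩
      obtain ⟨s', hs', hJ⟩ := (hmem I).1 hI
      exact ⟨s', hs', ((mem_nearIntervals_iff hτ).1 ⟨_, hJ, hIt⟩).2⟩
  obtain ⟨hsome, hnone⟩ := sweep_intervals Is.val hle
    (mergeSort_sorted (mapList (fun I : ℝ × ℝ × Fin n => (do
      spend 1
      return (I.1, I.2.2) : Timed (ℝ × Fin n))) Is.val).val)
    (mergeSort_sorted (mapList (fun I : ℝ × ℝ × Fin n => (do
      spend 1
      return (I.2.1, I.2.2) : Timed (ℝ × Fin n))) Is.val).val)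
    ((mergeSort_perm _).trans (by simp)) ((mergeSort_perm _).trans (by simp))
  generalize sweep _ _ _ _ = w at *
  obtain ⟨_ | t, c⟩ := w
  · refine ⟨by simp, fun _ z hz hfz => ?_⟩
    rw [Seg.points, segment_eq_image'] at hz
    obtain ⟨t, ht, rfl⟩ := hz
    obtain ⟨i, hi⟩ := hnone hn rfl t
    obtain ⟨I, hI, h1, h2, h3⟩ := (hfeas t ht).1 hfz i
    exact (hi I hI h1 h2).not_ge h3
  · simp only [Timed.val_bind, smul_val, vadd_val, Timed.val_pure, Option.some.injEq,
      reduceCtorEq, false_imp_iff, and_true, forall_eq']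
    have ht := hsome t rfl
    -- The sweep only places `t` in intervals; an interval of trajectory 0, which exists as `1 ≤ n`,
    -- confines it to the unit interval.
    have ht01 : 0 ≤ t ∧ t ≤ 1 := by
      obtain ⟨I, hI, -, hIt⟩ := ht ⟨0, hn⟩
      obtain ⟨s', -, hJ⟩ := (hmem I).1 hI
      exact ((mem_nearIntervals_iff hτ).1 ⟨_, hJ, hIt⟩).1
    exact (hfeas t ht01).2 ht

end Feasible

/-! ### The search for a radius -/

section Radius

variable {n k : ℕ}

theorem touchesAll_iff_feasible (hk : 1 ≤ k) {𝒯 : Fin n → Trajectory k} {B : Ball} :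
    TouchesAll B 𝒯 ↔ Feasible 𝒯 B.radius B.center := by
  refine forall_congr' fun i => ?_
  rw [infDist_le_iff_exists (isCompact_carrier _) (carrier_nonempty hk _)]
  simp only [dist_comm B.center]
  rfl

theorem Feasible.mono {𝒯 : Fin n → Trajectory k} {τ τ' : ℝ} {z : Point} (h : Feasible 𝒯 τ z)
    (hτ : τ ≤ τ') : Feasible 𝒯 τ' z := fun i => (h i).trans hτ

theorem Feasible.nonneg (hn : 1 ≤ n) {𝒯 : Fin n → Trajectory k} {τ : ℝ} {z : Point}
    (h : Feasible 𝒯 τ z) : 0 ≤ τ := Metric.infDist_nonneg.trans (h ⟨0, hn⟩)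

theorem Feasible.of_dist_le {𝒯 : Fin n → Trajectory k} {τ δ : ℝ} {y z : Point}
    (h : Feasible 𝒯 τ z) (hd : dist y z ≤ δ) : Feasible 𝒯 (τ + δ) y := fun i =>
  Metric.infDist_le_infDist_add_dist.trans (add_le_add (h i) hd)

theorem minRadius_eq (hk : 1 ≤ k) (𝒯 : Fin n → Trajectory k) :
    minRadius 𝒯 = sInf {r : ℝ | ∃ c, Feasible 𝒯 r c} := by
  simp only [minRadius, touchesAll_iff_feasible hk]

theorem minRadius_le (hn : 1 ≤ n) (hk : 1 ≤ k) {𝒯 : Fin n → Trajectory k} {τ : ℝ} {z : Point}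
    (h : Feasible 𝒯 τ z) : minRadius 𝒯 ≤ τ := by
  rw [minRadius_eq hk]
  exact csInf_le ⟨0, fun r ⟨c, hc⟩ => hc.nonneg hn⟩ ⟨z, h⟩

/-- Only thresholds strictly above the infimum are used, so attainment of `r*` is not needed. The
hypothesis `h` makes the set nonempty, which excludes the default value of `sInf`. -/
theorem exists_feasible_of_minRadius_lt (hk : 1 ≤ k) {𝒯 : Fin n → Trajectory k} {τ r : ℝ}
    {z : Point} (h : Feasible 𝒯 τ z) (hr : minRadius 𝒯 < r) : ∃ c, Feasible 𝒯 r c := by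
  rw [minRadius_eq hk] at hr
  have hne : {r : ℝ | ∃ c, Feasible 𝒯 r c}.Nonempty := ⟨τ, z, h⟩
  obtain ⟨r', ⟨c, hc⟩, hr'⟩ := exists_lt_of_csInf_lt hne hr
  exact ⟨c, hc.mono hr'.le⟩

theorem estimateRadBody_cost_le (hn : 1 ≤ n) (hk : 1 ≤ k) (𝒯 : Fin n → Trajectory k)
    (γ ρ : ℝ) (st : List Seg × Ball) :
    (estimateRadBody (inputSegments 𝒯) γ ρ st).cost ≤ roundCost n k := by
  obtain ⟨_ | ⟨s, L⟩, B⟩ := st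
  · have : 1 ≤ n * k := Nat.mul_pos hn hk
    simp only [estimateRadBody, Timed.cost_bind, spend_cost, mul_cost, Timed.cost_pure, roundCost]
    omega
  · have := feasiblePoint_cost_le hn hk 𝒯 s B.radius
    simp only [estimateRadBody, Timed.cost_bind, spend_cost, lt_val, lt_cost, decide_eq_true_eq,
      Timed.cost_ite, Timed.cost_pure]
    generalize feasiblePoint _ _ _ = w at *
    obtain ⟨_ | c, t⟩ := w
    · simp only [Timed.cost_pure] at *
      split_ifs <;> omega
    · simp only [Timed.cost_pure, Timed.cost_bind, div_cost] at *
      split_ifs <;> omega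

/-- The result of EstimateRad: at a threshold `τ'` where the search has stopped, the ball touches
every trajectory and has radius `γ * τ'`. -/
structure RadiusEstimate (𝒯 : Fin n → Trajectory k) (L : List Seg) (γ ρ τ : ℝ) (B : Ball)
    (τ' : ℝ) : Prop where
  radius_eq : B.radius = γ * τ'
  nonneg : 0 ≤ τ'
  le : τ' ≤ τ
  feasible : Feasible 𝒯 B.radius B.center
  stopped : τ' ≤ ρ ∨ ∀ s ∈ L, ∀ z ∈ s.points, ¬ Feasible 𝒯 τ' z

/-- Induction on the potential `L.length + m`, where `m` bounds the divisions still possible: a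
discarded segment lowers the length, a division lowers `m`. The center stays feasible at `γ` times
the threshold. -/
theorem estimateRad_runs (hn : 1 ≤ n) (hk : 1 ≤ k) (𝒯 : Fin n → Trajectory k) {γ ρ : ℝ}
    (hγ : 1 ≤ γ) (N : ℕ) (L : List Seg) (m : ℕ) (hN : L.length + m = N)
    (B : Ball) (hB : 0 ≤ B.radius) (hfeas : Feasible 𝒯 (γ * B.radius) B.center)
    (hm : B.radius < max (minRadius 𝒯) ρ * γ ^ m) :
    ∃ B' t τ', LoopRuns (estimateRadBody (inputSegments 𝒯) γ ρ) (L, B) B' t ∧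
      t ≤ roundCost n k * (N + 1) ∧ RadiusEstimate 𝒯 L γ ρ B.radius B' τ' := by
  have hγ0 : 0 < γ := by linarith
  induction N generalizing L m B with
  | zero =>
    obtain rfl : L = [] := List.length_eq_zero_iff.1 (by omega)
    have hv : (estimateRadBody (inputSegments 𝒯) γ ρ ([], B)).val =
        Sum.inl ⟨B.center, γ * B.radius⟩ := rfl
    refine ⟨_, _, B.radius, LoopRuns.of_inl hv, ?_, rfl, hB, le_rfl, hfeas, Or.inr (by simp)⟩
    simpa using estimateRadBody_cost_le hn hk 𝒯 γ ρ ([], B)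
  | succ N ih =>
    have hcost := estimateRadBody_cost_le hn hk 𝒯 γ ρ (L, B)
    cases L with
    | nil =>
      have hv : (estimateRadBody (inputSegments 𝒯) γ ρ ([], B)).val =
          Sum.inl ⟨B.center, γ * B.radius⟩ := rfl
      refine ⟨_, _, B.radius, LoopRuns.of_inl hv, ?_, rfl, hB, le_rfl, hfeas, Or.inr (by simp)⟩
      exact hcost.trans (Nat.le_mul_of_pos_right _ (by omega))
    | cons s L =>
      rw [List.length_cons] at hN
      by_cases hρB : ρ < B.radius
      · have hspec := feasiblePoint_spec hn hk 𝒯 s hB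
        cases hf : (feasiblePoint (inputSegments 𝒯) s B.radius).val with
        | none =>
          have hv : (estimateRadBody (inputSegments 𝒯) γ ρ (s :: L, B)).val = Sum.inr (L, B) := by
            simp [estimateRadBody, hρB, hf]
          obtain ⟨B', t, τ', hrun, ht, hR⟩ := ih L m (by omega) B hB hfeas hm
          refine ⟨B', _, τ', hrun.of_inr hv, ?_, hR.radius_eq, hR.nonneg, hR.le, hR.feasible, ?_⟩
          · rw [Nat.mul_succ]
            omega
          -- A discarded segment stays infeasible, as the threshold only decreases.
          · refine hR.stopped.imp_right fun h s' hs' z hz hfz => ?_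
            rcases List.mem_cons.1 hs' with rfl | hs'
            · exact hspec.2 hf z hz (hfz.mono hR.le)
            · exact h s' hs' z hz hfz
        | some c =>
          have hv : (estimateRadBody (inputSegments 𝒯) γ ρ (s :: L, B)).val =
              Sum.inr (s :: L, ⟨c, B.radius / γ⟩) := by
            simp [estimateRadBody, hρB, hf]
          have hc := hspec.1 c hf
          -- A division requires a threshold above `ρ` with a feasible point, hence at least `r*`;
          -- this rules out `m = 0`.
          have hM : max (minRadius 𝒯) ρ ≤ B.radius := max_le (minRadius_le hn hk hc) hρB.le
          cases m with
          | zero =>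
            rw [pow_zero, mul_one] at hm
            exact absurd hM hm.not_ge
          | succ m =>
            obtain ⟨B', t, τ', hrun, ht, hR⟩ := ih (s :: L) m (by simp; omega)
              ⟨c, B.radius / γ⟩ (by positivity)
              (by rwa [mul_div_cancel₀ _ hγ0.ne'])
              (by rwa [div_lt_iff₀ hγ0, mul_assoc, ← pow_succ])
            refine ⟨B', _, τ', hrun.of_inr hv, ?_, hR.radius_eq, hR.nonneg,
              hR.le.trans (div_le_self hB hγ), hR.feasible, hR.stopped⟩
            rw [Nat.mul_succ]
            omega
      · have hv : (estimateRadBody (inputSegments 𝒯) γ ρ (s :: L, B)).val = Sum.inr (L, B) := by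
          simp [estimateRadBody, hρB]
        obtain ⟨B', t, τ', hrun, ht, hR⟩ := ih L m (by omega) B hB hfeas hm
        refine ⟨B', _, τ', hrun.of_inr hv, ?_, hR.radius_eq, hR.nonneg, hR.le, hR.feasible,
          Or.inl (hR.le.trans (not_lt.1 hρB))⟩
        rw [Nat.mul_succ]
        omega

theorem estimateRad_returns (hn : 1 ≤ n) (hk : 1 ≤ k) (𝒯 : Fin n → Trajectory k) {γ ρ : ℝ}
    (hγ : 1 ≤ γ) (L : List Seg) (m : ℕ) {B : Ball} (hB : 0 ≤ B.radius)
    (hfeas : Feasible 𝒯 (γ * B.radius) B.center)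
    (hm : B.radius < max (minRadius 𝒯) ρ * γ ^ m) :
    ∃ B' t τ', (estimateRad (inputSegments 𝒯) L γ ρ B).Returns B' t ∧
      t ≤ roundCost n k * (L.length + m + 1) ∧ RadiusEstimate 𝒯 L γ ρ B.radius B' τ' := by
  obtain ⟨B', t, τ', hrun, h⟩ := estimateRad_runs hn hk 𝒯 hγ _ L m rfl B hB hfeas hm
  exact ⟨B', t, τ', hrun.returns, h⟩

end Radius

/-! ### Ghost trajectories -/

section Ghosts

/-- A unit direction `u` and a length `l` describe the segment even when it is a point (`l = 0`), so
later arguments need no case distinction. -/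
theorem ghostSegment_val (ε τ : ℝ) (s : Seg) : ∃ (u : Point) (l : ℝ), 0 ≤ l ∧
    u 0 ^ 2 + u 1 ^ 2 = 1 ∧ s.q = s.p + l • u ∧ ∀ i, (ghostSegment ε τ i s).val =
      ⟨s.p + (i * (τ * ε / 12)) • !₂[-u 1, u 0] - τ • u,
        s.q + (i * (τ * ε / 12)) • !₂[-u 1, u 0] + τ • u⟩ := by
  set l : ℝ := √((s.q - s.p) 0 * (s.q - s.p) 0 + (s.q - s.p) 1 * (s.q - s.p) 1) with hl
  have hsq : l ^ 2 = (s.q - s.p) 0 * (s.q - s.p) 0 + (s.q - s.p) 1 * (s.q - s.p) 1 :=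
    Real.sq_sqrt (add_nonneg (mul_self_nonneg _) (mul_self_nonneg _))
  have hl0 : 0 ≤ l := Real.sqrt_nonneg _
  refine ⟨if 0 < l then !₂[(s.q - s.p) 0 / l, (s.q - s.p) 1 / l] else !₂[1, 0], l, hl0, ?_, ?_, ?_⟩
  · split_ifs with h
    · simp only [Matrix.cons_val_zero, Matrix.cons_val_one, div_pow]
      rw [← add_div, div_eq_one_iff_eq (by positivity), hsq]
      ring
    · simp
  · split_ifs with h
    · ext i
      fin_cases i
      · have := mul_div_cancel₀ ((s.q - s.p) 0) h.ne'
        simp at this ⊢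
        field_simp
        ring
      · have := mul_div_cancel₀ ((s.q - s.p) 1) h.ne'
        simp at this ⊢
        field_simp
        ring
    · have h0 : l = 0 := le_antisymm (not_lt.1 h) hl0
      rw [h0] at hsq
      have e0 : (s.q - s.p) 0 = 0 := by
        nlinarith [sq_nonneg ((s.q - s.p) 0), sq_nonneg ((s.q - s.p) 1)]
      have e1 : (s.q - s.p) 1 = 0 := by
        nlinarith [sq_nonneg ((s.q - s.p) 0), sq_nonneg ((s.q - s.p) 1)]
      rw [PiLp.sub_apply, sub_eq_zero] at e0 e1
      ext i
      fin_cases i <;> simp [h0, e0, e1]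
  · intro i
    simp only [ghostSegment, Timed.val_bind, vsub_val, dot_val, sqrt_val, lt_val,
      decide_eq_true_eq, Timed.val_ite, Timed.val_pure, div_val, sub_val, mul_val, smul_val,
      vadd_val, zero_sub]
    rw [← hl]

theorem ghostSegment_cost_le (ε τ i : ℝ) (s : Seg) : (ghostSegment ε τ i s).cost ≤ 25 := by
  simp only [ghostSegment, Timed.cost_bind, vsub_cost, dot_cost, sqrt_cost, lt_cost, lt_val,
    decide_eq_true_eq, Timed.cost_ite, Timed.cost_pure, div_cost, sub_cost, mul_cost, smul_cost,
    vadd_cost]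
  split_ifs <;> norm_num

/-- Rounding `h / δ` towards zero keeps the index within the bound, which rounding to nearest might
not. `max M 0` covers `δ = 0`, where `M` is unconstrained. -/
theorem exists_int_mul_near {h δ M : ℝ} (hδ : 0 ≤ δ) (hh : |h| ≤ M * δ) :
    ∃ j : ℤ, |(j : ℝ)| ≤ max M 0 ∧ |h - j * δ| ≤ δ := by
  rcases hδ.eq_or_lt with rfl | hδ
  · refine ⟨0, by simp, ?_⟩
    simpa using hh
  obtain ⟨x, rfl⟩ : ∃ x, h = x * δ := ⟨h / δ, (div_mul_cancel₀ _ hδ.ne').symm⟩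
  rw [abs_mul, abs_of_pos hδ, mul_le_mul_iff_left₀ hδ] at hh
  suffices hs : ∃ j : ℤ, |(j : ℝ)| ≤ |x| ∧ |x - j| ≤ 1 by
    obtain ⟨j, h1, h2⟩ := hs
    refine ⟨j, h1.trans (hh.trans (le_max_left _ _)), ?_⟩
    rw [← sub_mul, abs_mul, abs_of_pos hδ]
    exact mul_le_of_le_one_left hδ.le h2
  rcases le_total 0 x with hx | hx
  · refine ⟨⌊x⌋, ?_, ?_⟩
    · rw [abs_of_nonneg hx, abs_of_nonneg (by exact_mod_cast Int.floor_nonneg.2 hx)]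
      exact Int.floor_le x
    · rw [abs_le]
      constructor <;> linarith [Int.floor_le x, Int.lt_floor_add_one x]
  · refine ⟨⌈x⌉, ?_, ?_⟩
    · rw [abs_of_nonpos hx, abs_of_nonpos (by exact_mod_cast Int.ceil_le.2 (by simpa using hx))]
      exact neg_le_neg (Int.le_ceil x)
    · rw [abs_le]
      constructor <;> linarith [Int.le_ceil x, Int.ceil_lt_add_one x]

theorem add_smul_mem_segment {x l : ℝ} (hx : 0 ≤ x) (hxl : x ≤ l) (p u : Point) :
    p + x • u ∈ segment ℝ p (p + l • u) := by
  rw [segment_eq_image']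
  -- If `l = 0` then `x = 0`, and the convention `0 / 0 = 0` gives the right parameter.
  refine ⟨x / l, ⟨div_nonneg hx (hx.trans hxl), div_le_one_of_le₀ hxl (hx.trans hxl)⟩, ?_⟩
  simp only [add_sub_cancel_left, smul_smul]
  rw [div_mul_cancel_of_imp fun h => le_antisymm (h ▸ hxl) hx]

/-- Every point at distance at most `τ` from a segment is close to one of its ghosts. -/
theorem exists_ghostSegment_near {ε τ : ℝ} (hε : 0 < ε) (hτ : 0 ≤ τ) {s : Seg} {z : Point}
    (hz : Metric.infDist z s.points ≤ τ) : ∃ j : ℤ, |(j : ℝ)| ≤ 12 / ε ∧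
      Metric.infDist z (ghostSegment ε τ j s).val.points ≤ ε * τ / 12 := by
  obtain ⟨y, hy, hzy⟩ := (infDist_le_iff_exists (isCompact_points s) (points_nonempty s)).1 hz
  obtain ⟨u, l, hl, hu, hq, hval⟩ := ghostSegment_val ε τ s
  rw [Seg.points, segment_eq_image'] at hy
  obtain ⟨θ, ⟨hθ0, hθ1⟩, rfl⟩ := hy
  rw [hq] at hzy
  simp only [add_sub_cancel_left] at hzy
  set v := z - (s.p + θ • l • u) with hv
  rw [dist_eq_norm, ← hv, ← dist_zero_right, point_dist_le_iff hτ] at hzy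
  simp only [PiLp.zero_apply, sub_zero] at hzy
  -- `a` and `h` are the components of the offset along `u` and along its normal. The extension by
  -- `τ` absorbs `a`, since `|a| ≤ τ`; the shift approximates `h`, where `|h| ≤ τ` equals `12 / ε`
  -- times the spacing.
  set a := v 0 * u 0 + v 1 * u 1 with ha
  set h := v 1 * u 0 - v 0 * u 1 with hh
  have hah : a ^ 2 + h ^ 2 ≤ τ ^ 2 := by
    have : a ^ 2 + h ^ 2 = (v 0 ^ 2 + v 1 ^ 2) * (u 0 ^ 2 + u 1 ^ 2) := by rw [ha, hh]; ring
    rwa [this, hu, mul_one]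
  have ha' : |a| ≤ τ := abs_le_of_sq_le_sq (by nlinarith [sq_nonneg h]) hτ
  have hh' : |h| ≤ τ := abs_le_of_sq_le_sq (by nlinarith [sq_nonneg a]) hτ
  have hδ : 0 ≤ τ * ε / 12 := by positivity
  obtain ⟨j, hj, hjh⟩ := exists_int_mul_near (M := 12 / ε) hδ
    (hh'.trans (le_of_eq (by field_simp)))
  rw [max_eq_left (by positivity)] at hj
  refine ⟨j, hj, ?_⟩
  rw [infDist_le_iff_exists (isCompact_points _) (points_nonempty _)]
  have hmem := add_smul_mem_segment (x := θ * l + a + τ) (l := l + 2 * τ)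
    (by have := abs_le.1 ha'; nlinarith [mul_nonneg hθ0 hl])
    (by have := abs_le.1 ha'; nlinarith [mul_nonneg (sub_nonneg.2 hθ1) hl])
    (s.p + ((j : ℝ) * (τ * ε / 12)) • !₂[-u 1, u 0] - τ • u) u
  refine ⟨s.p + ((j : ℝ) * (τ * ε / 12)) • !₂[-u 1, u 0] - τ • u + (θ * l + a + τ) • u, ?_, ?_⟩
  · rw [hval, Seg.points]
    convert hmem using 2
    simp only [hq]
    module
  · rw [point_dist_le_iff (by positivity)]
    have hz0 : z 0 = s.p 0 + θ * (l * u 0) + v 0 := by simp [hv]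
    have hz1 : z 1 = s.p 1 + θ * (l * u 1) + v 1 := by simp [hv]
    have hsq : (h - j * (τ * ε / 12)) ^ 2 ≤ (ε * τ / 12) ^ 2 := by
      rw [mul_comm ε τ]
      exact sq_le_sq' (by linarith [(abs_le.1 hjh).1]) (abs_le.1 hjh).2
    refine le_trans (le_of_eq ?_) hsq
    simp only [PiLp.add_apply, PiLp.sub_apply, PiLp.smul_apply, smul_eq_mul,
      Matrix.cons_val_zero, Matrix.cons_val_one, hz0, hz1]
    have hv0 : v 0 = a * u 0 - h * u 1 := by
      rw [ha, hh]
      linear_combination -(v 0) * hu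
    have hv1 : v 1 = a * u 1 + h * u 0 := by
      rw [ha, hh]
      linear_combination -(v 1) * hu
    rw [hv0, hv1]
    linear_combination (h - j * (τ * ε / 12)) ^ 2 * hu

theorem ghostTrajectory_val (ε τ : ℝ) (S : List Seg) (i : ℝ) :
    (ghostTrajectory ε τ S i).val = S.map fun s => (ghostSegment ε τ i s).val := mapList_val _ _

theorem ghostTrajectory_cost_le (ε τ : ℝ) (S : List Seg) (i : ℝ) :
    (ghostTrajectory ε τ S i).cost ≤ 26 * S.length + 1 :=
  mapList_cost_le _ _ 25 fun s _ => ghostSegment_cost_le ε τ i s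

/-- `m` counts the positive indices still to be treated; the additional round is the one that fails
the test and stops. -/
theorem ghostsBody_runs {ε : ℝ} (hε : 0 < ε) (τ : ℝ) (S : List Seg) (m i : ℕ)
    (hi : i + m = ⌊12 / ε⌋₊ + 1) (Gs : List (List Seg)) :
    ∃ out t, LoopRuns (ghostsBody ε τ S) ((i : ℝ), Gs) out t ∧
      t ≤ (52 * S.length + 8) * (m + 1) ∧ out.length = Gs.length + 2 * m ∧
      (∀ G ∈ Gs, G ∈ out) ∧ (∀ G ∈ out, G ∈ Gs ∨ ∃ x, G = (ghostTrajectory ε τ S x).val) ∧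
      ∀ j : ℕ, i ≤ j → j ≤ ⌊12 / ε⌋₊ → (ghostTrajectory ε τ S j).val ∈ out ∧
        (ghostTrajectory ε τ S (-j)).val ∈ out := by
  have hle : (i : ℝ) * ε ≤ 12 ↔ i ≤ ⌊12 / ε⌋₊ := by
    rw [Nat.le_floor_iff (by positivity), le_div_iff₀ hε]
  induction m generalizing i Gs with
  | zero =>
    have hi' : ¬ (i : ℝ) * ε ≤ 12 := by rw [hle]; omega
    have hv : (ghostsBody ε τ S ((i : ℝ), Gs)).val = Sum.inl Gs := by simp [ghostsBody, hi']
    refine ⟨Gs, _, LoopRuns.of_inl hv, ?_, by simp, fun _ h => h, fun _ h => Or.inl h, ?_⟩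
    · simp [ghostsBody, hi']
    · intro j h1 h2
      omega
  | succ m ih =>
    have hi' : (i : ℝ) * ε ≤ 12 := by rw [hle]; omega
    have hv : (ghostsBody ε τ S ((i : ℝ), Gs)).val = Sum.inr (((i + 1 : ℕ) : ℝ),
        (ghostTrajectory ε τ S i).val :: (ghostTrajectory ε τ S (-i)).val :: Gs) := by
      simp [ghostsBody, hi']
    have hc : (ghostsBody ε τ S ((i : ℝ), Gs)).cost ≤ 52 * S.length + 8 := by
      have h1 := ghostTrajectory_cost_le ε τ S i
      have h2 := ghostTrajectory_cost_le ε τ S (-i)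
      simp [ghostsBody, hi']
      omega
    obtain ⟨out, t, hrun, ht, hlen, hsub, hout, hj⟩ := ih (i + 1) (by omega)
      ((ghostTrajectory ε τ S i).val :: (ghostTrajectory ε τ S (-i)).val :: Gs)
      (by rw [Nat.le_floor_iff (by positivity), le_div_iff₀ hε])
    refine ⟨out, _, hrun.of_inr hv, ?_, ?_, ?_, ?_, ?_⟩
    · rw [Nat.mul_succ]
      omega
    · rw [hlen]
      simp
      omega
    · intro G hG
      exact hsub G (by simp [hG])
    · intro G hG
      rcases hout G hG with h | h
      · simp only [List.mem_cons] at h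
        rcases h with h | h | h
        · exact Or.inr ⟨_, h⟩
        · exact Or.inr ⟨_, h⟩
        · exact Or.inl h
      · exact Or.inr h
    · intro j h1 h2
      rcases h1.eq_or_lt with rfl | h1
      · exact ⟨hsub _ (by simp), hsub _ (by simp)⟩
      · exact hj j h1 h2

theorem ghosts_returns {ε : ℝ} (hε : 0 < ε) (τ : ℝ) (S : List Seg) :
    ∃ out t, (ghosts ε τ S).Returns out t ∧
      t ≤ (52 * S.length + 8) * (⌊12 / ε⌋₊ + 2) ∧ out.length = 2 * ⌊12 / ε⌋₊ + 1 ∧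
      (∀ G ∈ out, ∃ x, G = (ghostTrajectory ε τ S x).val) ∧
      ∀ j : ℤ, |(j : ℝ)| ≤ 12 / ε → (ghostTrajectory ε τ S j).val ∈ out := by
  obtain ⟨out, t, hrun, ht, hlen, hsub, hout, hj⟩ := ghostsBody_runs hε τ S ⌊12 / ε⌋₊ 1
    (add_comm _ _) [(ghostTrajectory ε τ S 0).val]
  rw [Nat.cast_one] at hrun
  refine ⟨out, _, (Program.returns_lift (ghostTrajectory ε τ S 0)).bind hrun.returns,
    ?_, ?_, ?_, ?_⟩
  · have := ghostTrajectory_cost_le ε τ S 0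
    have h2 : (52 * S.length + 8) * (⌊12 / ε⌋₊ + 2) =
      (52 * S.length + 8) * (⌊12 / ε⌋₊ + 1) + (52 * S.length + 8) := by ring
    omega
  · rw [hlen]
    simp
    omega
  · intro G hG
    rcases hout G hG with h | h
    · exact ⟨0, by simpa using h⟩
    · exact h
  · intro j hje
    have hn : j.natAbs ≤ ⌊12 / ε⌋₊ := by
      refine Nat.le_floor ?_
      rwa [Nat.cast_natAbs, Int.cast_abs]
    rcases Nat.eq_zero_or_pos j.natAbs with h0 | h0
    · obtain rfl := Int.natAbs_eq_zero.1 h0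
      exact hsub _ (by simp)
    · have := hj j.natAbs h0 hn
      have hcast : (j.natAbs : ℝ) = ((j.natAbs : ℤ) : ℝ) := by simp
      rcases Int.natAbs_eq j with h | h
      · rw [h, ← hcast]
        exact this.1
      · rw [h, Int.cast_neg, ← hcast]
        exact this.2

end Ghosts

/-! ### The two approximation bounds -/

section Bounds

variable {n k : ℕ}

/-- These two bounds are all that is needed of `Δ̂`: it covers the first waypoint of every
trajectory, and it is a maximum over waypoints, which lie in the union. -/
theorem furthest_spec (hk : 1 ≤ k) (𝒯 : Fin n → Trajectory k) (i₀ : Fin n) :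
    Feasible 𝒯 (furthest (𝒯 i₀ 0) (inputSegments 𝒯)).val (𝒯 i₀ 0) ∧
    (furthest (𝒯 i₀ 0) (inputSegments 𝒯)).val ≤ diameter 𝒯 := by
  simp only [furthest, Timed.val_bind, mapList_val, distance_val]
  constructor
  · intro i
    refine (Metric.infDist_le_dist_of_mem (start_mem_carrier hk (𝒯 i))).trans ?_
    have hs : (⟨𝒯 i 0, 𝒯 i (Fin.succ ⟨0, hk⟩)⟩ : Seg) ∈ segments (𝒯 i) :=
      List.mem_ofFn.2 ⟨⟨0, hk⟩, rfl⟩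
    refine le_trans ?_ ((le_maxList _ _).2 _ (List.mem_map.2 ⟨(i, segments (𝒯 i)),
      mem_inputSegments.2 rfl, rfl⟩))
    refine le_trans ?_ ((le_maxList _ _).2 _ (List.mem_map.2 ⟨_, hs, rfl⟩))
    exact (le_maxList _ _).1
  · have hbdd : Bornology.IsBounded (⋃ i, carrier (𝒯 i)) :=
      (isCompact_iUnion fun i => isCompact_carrier (𝒯 i)).isBounded
    have hd : ∀ i, ∀ z ∈ carrier (𝒯 i), dist (𝒯 i₀ 0) z ≤ diameter 𝒯 := fun i z hz =>
      Metric.dist_le_diam_of_mem hbdd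
        (Set.mem_iUnion.2 ⟨i₀, start_mem_carrier hk (𝒯 i₀)⟩) (Set.mem_iUnion.2 ⟨i, hz⟩)
    refine maxList_le Metric.diam_nonneg ?_
    intro x hx
    obtain ⟨S, hS, rfl⟩ := List.mem_map.1 hx
    refine maxList_le Metric.diam_nonneg ?_
    intro x hx
    obtain ⟨s, hs, rfl⟩ := List.mem_map.1 hx
    rw [mem_inputSegments.1 hS] at hs
    refine maxList_le (hd S.1 _ (mem_carrier_iff.2 ⟨s, hs, left_mem_segment ℝ _ _⟩)) ?_
    simpa using hd S.1 _ (mem_carrier_iff.2 ⟨s, hs, right_mem_segment ℝ _ _⟩)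

theorem furthest_cost_le (x : Point) (𝒯 : Fin n → Trajectory k) :
    (furthest x (inputSegments 𝒯)).cost ≤ (18 * k + 5) * n + 2 := by
  have h := mapList_cost_le (fun S : Fin n × List Seg => do
    let es ← mapList (fun s : Seg => do
      let u ← distance x s.p
      let v ← distance x s.q
      maxList u [v]) S.2
    maxList 0 es) (inputSegments 𝒯) (18 * k + 2) ?_
  · rw [length_inputSegments] at h
    simp only [furthest, Timed.cost_bind, maxList_cost, mapList_val, List.length_map,
      length_inputSegments]
    nlinarith
  · intro S hS
    have hS := congrArg List.length (mem_inputSegments.1 hS)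
    rw [length_segments] at hS
    have h := mapList_cost_le (fun s : Seg => do
      let u ← distance x s.p
      let v ← distance x s.q
      maxList u [v]) S.2 15 (fun s _ => by simp [maxList_cost])
    simp only [Timed.cost_bind, maxList_cost, mapList_val, List.length_map]
    rw [hS] at *
    omega

/-- If `τ' > 2 * r*`, some center is feasible at `τ' / 2`; its nearest point on the chosen
trajectory is then feasible at `τ'`, contradicting the stop. -/
theorem RadiusEstimate.le_four_mul (hk : 1 ≤ k) {𝒯 : Fin n → Trajectory k} {i₀ : Fin n}
    {ρ τ τ' : ℝ} {B : Ball} (hM : 0 < max (minRadius 𝒯) ρ)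
    (h : RadiusEstimate 𝒯 (segments (𝒯 i₀)) 2 ρ τ B τ') :
    B.radius ≤ 4 * max (minRadius 𝒯) ρ := by
  rw [h.radius_eq]
  have hr := le_max_left (minRadius 𝒯) ρ
  have hρ := le_max_right (minRadius 𝒯) ρ
  rcases h.stopped with hs | hs
  · linarith
  · suffices τ' ≤ 2 * minRadius 𝒯 by linarith
    by_contra! hcon
    obtain ⟨c, hc⟩ := exists_feasible_of_minRadius_lt hk h.feasible
      (show minRadius 𝒯 < τ' / 2 by linarith)
    obtain ⟨s, hs', hd⟩ := (infDist_carrier_le_iff hk).1 (hc i₀)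
    obtain ⟨y, hy, hcy⟩ := (infDist_le_iff_exists (isCompact_points s) (points_nonempty s)).1 hd
    refine hs s hs' y hy ?_
    rw [← add_halves τ']
    exact hc.of_dist_le (dist_comm c y ▸ hcy)

/-- A center feasible at `τ' - ε * τ / 12` lies in the sausage, since `τ' ≤ τ`; a point of `L`
within `ε * τ / 12` of it is feasible at `τ'`. The search therefore cannot stop while `τ'` exceeds
both `ρ` and `r* + ε * τ / 12`. -/
theorem RadiusEstimate.le_one_add_mul (hk : 1 ≤ k) {𝒯 : Fin n → Trajectory k} {i₀ : Fin n}
    {ε ρ τ τ' : ℝ} {L : List Seg} {B : Ball} (hε : 0 < ε) (hε1 : ε ≤ 1 / 2)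
    (hτ : τ ≤ 4 * max (minRadius 𝒯) ρ) (hM : 0 < max (minRadius 𝒯) ρ)
    (hL : ∀ x ∈ sausage (𝒯 i₀) τ, ∃ s ∈ L, Metric.infDist x s.points ≤ ε * τ / 12)
    (h : RadiusEstimate 𝒯 L (1 + ε / 3) ρ τ B τ') :
    B.radius ≤ (1 + ε) * max (minRadius 𝒯) ρ := by
  rw [h.radius_eq]
  set M := max (minRadius 𝒯) ρ with hMdef
  have hr : minRadius 𝒯 ≤ M := le_max_left (minRadius 𝒯) ρ
  have hρ : ρ ≤ M := le_max_right (minRadius 𝒯) ρ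
  have hεM : 0 < ε * M := mul_pos hε hM
  suffices hs : τ' ≤ (1 + ε / 3) * M by
    refine (mul_le_mul_of_nonneg_left hs (by linarith)).trans ?_
    nlinarith [mul_pos hε hεM]
  rcases h.stopped with hs | hs
  · linarith
  · by_contra! hcon
    have hετ : ε * τ / 12 ≤ ε * M / 3 := by nlinarith [mul_le_mul_of_nonneg_left hτ hε.le]
    have hτ0 : 0 ≤ ε * τ / 12 := by have := h.nonneg.trans h.le; positivity
    obtain ⟨c, hc⟩ := exists_feasible_of_minRadius_lt hk h.feasible
      (show minRadius 𝒯 < τ' - ε * τ / 12 by linarith)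
    obtain ⟨s, hsL, hd⟩ := hL c ((hc i₀).trans (by linarith [h.le]))
    obtain ⟨y, hy, hcy⟩ := (infDist_le_iff_exists (isCompact_points s) (points_nonempty s)).1 hd
    refine hs s hsL y hy ?_
    rw [← sub_add_cancel τ' (ε * τ / 12)]
    exact hc.of_dist_le (dist_comm c y ▸ hcy)

theorem exists_ghost_near (hk : 1 ≤ k) {T : Trajectory k} {ε τ : ℝ} (hε : 0 < ε) (hτ : 0 ≤ τ)
    {Gs : List (List Seg)}
    (hG : ∀ j : ℤ, |(j : ℝ)| ≤ 12 / ε → (ghostTrajectory ε τ (segments T) j).val ∈ Gs) :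
    ∀ x ∈ sausage T τ, ∃ G ∈ Gs, ∃ s ∈ G, Metric.infDist x s.points ≤ ε * τ / 12 := by
  intro x hx
  obtain ⟨s, hs, hd⟩ := (infDist_carrier_le_iff hk).1 hx
  obtain ⟨j, hj, hjd⟩ := exists_ghostSegment_near hε hτ hd
  refine ⟨_, hG j hj, _, ?_, hjd⟩
  rw [ghostTrajectory_val]
  exact List.mem_map.2 ⟨s, hs, rfl⟩

end Bounds

/-! ### Estimates for the number of steps -/

section Estimates

theorem exists_lt_two_pow (x : ℝ) :
    ∃ m : ℕ, x < 2 ^ m ∧ (m : ℝ) ≤ 2 * Real.posLog x + 1 := by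
  rcases lt_or_ge x 1 with h | h
  · refine ⟨0, by simpa, ?_⟩
    have := Real.posLog_nonneg (x := x)
    push_cast
    linarith
  have hl := Real.log_two_gt_d9
  have hlog : 0 ≤ Real.log x := Real.log_nonneg h
  refine ⟨⌊Real.log x / Real.log 2⌋₊ + 1, ?_, ?_⟩
  · rw [← Real.log_lt_log_iff (by linarith) (by positivity), Real.log_pow,
      ← div_lt_iff₀ (by linarith)]
    exact_mod_cast Nat.lt_floor_add_one _
  · have h1 := Nat.floor_le (a := Real.log x / Real.log 2) (div_nonneg hlog (by linarith))
    have h2 : Real.log x / Real.log 2 ≤ 2 * Real.log x := by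
      rw [div_le_iff₀ (by linarith)]
      nlinarith
    have h3 : Real.log x ≤ Real.posLog x := le_max_right _ _
    push_cast
    linarith

/-- From `2 ^ (clog - 1) < 3 * x ≤ (x + 1) ^ 2` one gets `clog * log 2 ≤ 3 * log (x + 1)`, and `3 /
log 2 < 5`. -/
theorem clog_three_mul_le {x : ℕ} (hx : 1 ≤ x) :
    (Nat.clog 2 (3 * x) : ℝ) ≤ 5 * Real.log (x + 1) := by
  have hl := Real.log_two_gt_d9
  have hpow := Nat.pow_pred_clog_lt_self one_lt_two (x := 3 * x) (by omega)
  have hlt : (2 : ℝ) ^ (Nat.clog 2 (3 * x)).pred ≤ ((x : ℝ) + 1) ^ 2 := by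
    have : 2 ^ (Nat.clog 2 (3 * x)).pred ≤ (x + 1) ^ 2 := by nlinarith
    exact_mod_cast this
  have hlog := Real.log_le_log (by positivity) hlt
  rw [Real.log_pow, Real.log_pow] at hlog
  have hx' : (1 : ℝ) ≤ x := by exact_mod_cast hx
  have h2 : Real.log 2 ≤ Real.log (x + 1) := Real.log_le_log (by norm_num) (by linarith)
  have hp : (Nat.clog 2 (3 * x) : ℝ) ≤ (Nat.clog 2 (3 * x)).pred + 1 := by
    exact_mod_cast Nat.pred_le_iff.1 le_rfl
  push_cast at hlog
  nlinarith

theorem roundCost_le {n k : ℕ} (hn : 1 ≤ n) (hk : 1 ≤ k) :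
    (roundCost n k : ℝ) ≤ 400 * (n * k * Real.log (n * k + 1)) := by
  have hl := Real.log_two_gt_d9
  have hnk : 1 ≤ n * k := Nat.mul_pos hn hk
  have hc := clog_three_mul_le hnk
  have hx : (1 : ℝ) ≤ ((n * k : ℕ) : ℝ) := by exact_mod_cast hnk
  have h2 : Real.log 2 ≤ Real.log ((n * k : ℕ) + 1) := Real.log_le_log (by norm_num) (by linarith)
  rw [roundCost, ← Nat.cast_mul n k]
  generalize n * k = x at *
  push_cast
  have : 212 + 18 * (Nat.clog 2 (3 * x) : ℝ) ≤ 400 * Real.log (x + 1) := by linarith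
  nlinarith

end Estimates

/-! ### The main theorem -/

theorem estimateTMBT_returns {n k : ℕ} {𝒯 : Fin n → Trajectory k} {i₀ : Fin n} {ε ρ : ℝ}
    {E B : Ball} {Gs : List (List Seg)} {t₁ t₂ t₃ : ℕ}
    (hE : (estimateRad (inputSegments 𝒯) (segments (𝒯 i₀)) 2 ρ
      ⟨𝒯 i₀ 0, 2 * (furthest (𝒯 i₀ 0) (inputSegments 𝒯)).val⟩).Returns E t₁)
    (hG : (ghosts ε E.radius (segments (𝒯 i₀))).Returns Gs t₂)
    (hB : (estimateRad (inputSegments 𝒯) Gs.flatten (1 + ε / 3) ρ E).Returns B t₃) :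
    (estimateTMBT 𝒯 i₀ ε ρ).Returns ⟨E, Gs, B⟩ ((readInput 𝒯).cost + (k + 1 +
      ((furthest (𝒯 i₀ 0) (inputSegments 𝒯)).cost + (1 + (t₁ + (t₂ + ((flatten Gs).cost +
        (1 + (1 + (t₃ + 0)))))))))) := by
  unfold estimateTMBT
  refine (Program.returns_lift (readInput 𝒯)).bind ?_
  rw [readInput_val]
  refine (Program.returns_lift (readSegments (𝒯 i₀))).bind ?_
  rw [readSegments_val]
  refine (Program.returns_lift (furthest _ _)).bind ?_
  refine (Program.returns_lift (mul 2 _)).bind ?_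
  refine hE.bind (hG.bind ?_)
  refine (Program.returns_lift (flatten Gs)).bind ?_
  rw [flatten_val]
  refine (Program.returns_lift (div ε 3)).bind ?_
  refine (Program.returns_lift (add 1 _)).bind ?_
  exact hB.bind (Program.returns_pure _)

theorem estimateTMBT_correct {n k : ℕ} (𝒯 : Fin n → Trajectory k) (i₀ : Fin n) {ε ρ : ℝ}
    (hk : 1 ≤ k) (hε : 0 < ε) (hε1 : ε ≤ 1 / 2) (hM : 0 < max (minRadius 𝒯) ρ) :
    ∃ (out : Outcome) (steps : ℕ), (estimateTMBT 𝒯 i₀ ε ρ).Returns out steps ∧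
      IsApproxTMTB ε ρ 𝒯 out.ball ∧
      (steps : ℝ) ≤ 30000 * (n * k * Real.log (n * k + 1) * (1 / ε) *
        (Real.posLog (diameter 𝒯 / max (minRadius 𝒯) ρ) + k)) ∧
      IsApproxTMTB 3 ρ 𝒯 out.estimate ∧
      (out.ghosts.length : ℝ) ≤ 25 / ε ∧
      (∀ G ∈ out.ghosts, G.length = k) ∧
      ∀ x ∈ sausage (𝒯 i₀) out.estimate.radius, ∃ G ∈ out.ghosts, ∃ s ∈ G,
        Metric.infDist x s.points ≤ ε * out.estimate.radius / 12 := by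
  have hn : 1 ≤ n := Fin.pos i₀
  obtain ⟨hfar, hdiam⟩ := furthest_spec hk 𝒯 i₀
  have hfcost := furthest_cost_le (𝒯 i₀ 0) 𝒯
  have hΔ := hfar.nonneg hn
  obtain ⟨m₁, hm₁, hm₁'⟩ := exists_lt_two_pow
    (diameter 𝒯 / max (minRadius 𝒯) ρ)
  obtain ⟨E, t₁, τ₁, hE, ht₁, hRE⟩ := estimateRad_returns hn hk 𝒯 (γ := 2) (ρ := ρ) one_le_two
    -- The additional halving accounts for the factor 2 in the initial threshold `2 * Δ̂`.
    (segments (𝒯 i₀)) (m₁ + 1)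
    (B := ⟨𝒯 i₀ 0, 2 * (furthest (𝒯 i₀ 0) (inputSegments 𝒯)).val⟩) (by simpa)
    (hfar.mono (by simp; linarith)) (by
      rw [div_lt_iff₀ hM] at hm₁
      rw [pow_succ]
      simp only
      linarith)
  have hE0 : 0 ≤ E.radius := by rw [hRE.radius_eq]; linarith [hRE.nonneg]
  have hE4 := hRE.le_four_mul hk hM
  obtain ⟨Gs, t₂, hG, ht₂, hGlen, hGmem, hGall⟩ := ghosts_returns hε E.radius (segments (𝒯 i₀))
  have hGk : ∀ G ∈ Gs, G.length = k := by
    intro G hG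
    obtain ⟨x, rfl⟩ := hGmem G hG
    simp [ghostTrajectory_val]
  have hGnear := exists_ghost_near hk hε hE0 hGall
  obtain ⟨B, t₃, τ₂, hB, ht₃, hRB⟩ := estimateRad_returns hn hk 𝒯 (γ := 1 + ε / 3) (ρ := ρ)
    (by linarith) Gs.flatten (⌊9 / ε⌋₊ + 1) hE0
    (hRE.feasible.mono (by nlinarith [mul_nonneg hε.le hE0])) (by
      -- Bernoulli: `(1 + ε/3) ^ m ≥ 1 + m * ε / 3 > 4` once `m > 9 / ε`, and the search starts at
      -- most at `4 * M`.
      have h1 := one_add_mul_le_pow (show -2 ≤ ε / 3 by linarith) (⌊9 / ε⌋₊ + 1)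
      have h2 := Nat.lt_floor_add_one (9 / ε)
      rw [div_lt_iff₀ hε] at h2
      push_cast at h1
      nlinarith)
  have hrun := estimateTMBT_returns hE hG hB
  refine ⟨⟨E, Gs, B⟩, _, hrun, ⟨?_, ?_⟩, ?_, ⟨?_, ?_⟩, ?_, hGk, hGnear⟩
  · exact (touchesAll_iff_feasible hk).2 hRB.feasible
  · refine hRB.le_one_add_mul hk (i₀ := i₀) hε hε1 hE4 hM fun x hx => ?_
    obtain ⟨G, hG, s, hs, hd⟩ := hGnear x hx
    exact ⟨s, List.mem_flatten.2 ⟨G, hG, hs⟩, hd⟩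
  · have hK := roundCost_le hn hk
    have hLlen : Gs.flatten.length ≤ k * (2 * ⌊12 / ε⌋₊ + 1) := by
      rw [← hGlen]
      exact length_flatten_le _ k fun G hG => (hGk G hG).le
    have hN := Nat.floor_le (a := 12 / ε) (by positivity)
    have hm₂ := Nat.floor_le (a := 9 / ε) (by positivity)
    have hnk : n ≤ n * k := Nat.le_mul_of_pos_right n hk
    have hnk' : k ≤ n * k := Nat.le_mul_of_pos_left k hn
    have hK0 : 212 * (n * k) ≤ roundCost n k := Nat.le_add_right _ _
    have hinput := readInput_cost_le 𝒯
    rw [length_segments] at ht₁ ht₂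
    rw [flatten_cost, hGlen]
    set N := ⌊12 / ε⌋₊
    set m₂ := ⌊9 / ε⌋₊
    set K := roundCost n k
    -- In units of one round, the summands pay for reading the input with `furthest` and the single
    -- operations, the first search, building the ghosts, flattening them, and the second search.
    have hnat : (readInput 𝒯).cost + (k + 1 + ((furthest (𝒯 i₀ 0) (inputSegments 𝒯)).cost +
        (1 + (t₁ + (t₂ + ((Gs.flatten.length + 2 * (2 * N + 1) + 1) +
        (1 + (1 + (t₃ + 0))))))))) ≤
        K * (1 + (k + m₁ + 2) + (N + 2) + (2 * N + 1) + (k * (2 * N + 1) + m₂ + 2)) := by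
      have h1 : (k + 3) * n + 2 + (k + 1) + ((18 * k + 5) * n + 2) + 3 ≤ K := by nlinarith
      have h2 : (52 * k + 8) * (N + 2) ≤ K * (N + 2) := Nat.mul_le_mul_right _ (by omega)
      have h3 : Gs.flatten.length + 2 * (2 * N + 1) + 1 ≤ K * (2 * N + 1) := by
        have : (k + 3) * (2 * N + 1) ≤ K * (2 * N + 1) := Nat.mul_le_mul_right _ (by omega)
        nlinarith
      have h4 : t₃ ≤ K * (k * (2 * N + 1) + m₂ + 2) :=
        ht₃.trans (Nat.mul_le_mul_left _ (by omega))
      have h5 : t₁ ≤ K * (k + m₁ + 2) := ht₁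
      simp only [Nat.mul_add K] at *
      omega
    refine (Nat.cast_le.2 hnat).trans ?_
    set P := Real.posLog (diameter 𝒯 / max (minRadius 𝒯) ρ)
    have hP : 0 ≤ P := Real.posLog_nonneg
    have hk1 : (1 : ℝ) ≤ k := by exact_mod_cast hk
    have hi : 2 ≤ 1 / ε := by rw [le_div_iff₀ hε]; linarith
    have h12 : 12 / ε = 12 * (1 / ε) := by ring
    have h9 : 9 / ε = 9 * (1 / ε) := by ring
    rw [h12] at hN
    rw [h9] at hm₂
    set q := 1 / ε
    -- The dominant term is `2 * k * N ≤ 24 * k * q`; `1 ≤ k` and `2 ≤ q` absorb the rest. With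
    -- `roundCost_le` the final constant is `400 * 75 = 30000`.
    have hcount : ((1 + (k + m₁ + 2) + (N + 2) + (2 * N + 1) +
        (k * (2 * N + 1) + m₂ + 2) : ℕ) : ℝ) ≤ 75 * (q * (P + k)) := by
      push_cast
      have a1 : (k : ℝ) * N ≤ k * (12 * q) := mul_le_mul_of_nonneg_left hN (by linarith)
      have a2 : q * 1 ≤ q * k := mul_le_mul_of_nonneg_left hk1 (by linarith)
      have a3 : 2 * (k : ℝ) ≤ q * k := mul_le_mul_of_nonneg_right hi (by linarith)
      have a4 : 2 * P ≤ q * P := mul_le_mul_of_nonneg_right hi hP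
      nlinarith
    rw [Nat.cast_mul]
    refine (mul_le_mul hK hcount (Nat.cast_nonneg _) ((Nat.cast_nonneg _).trans hK)).trans ?_
    exact le_of_eq (by ring)
  · exact (touchesAll_iff_feasible hk).2 hRE.feasible
  · linarith
  · have hN := Nat.floor_le (a := 12 / ε) (by positivity)
    simp only [hGlen]
    push_cast
    rw [le_div_iff₀ hε] at hN ⊢
    linarith

end TMTB

end

theorem theorem2 :
    ∃ C : ℝ, 0 < C ∧
      ∀ (n k : ℕ) (𝒯 : Fin n → TMTB.Trajectory k) (i₀ : Fin n) (ε ρ : ℝ),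
        1 ≤ k → 0 < ε → ε ≤ 1 / 2 → 0 ≤ ρ → 0 < max (TMTB.minRadius 𝒯) ρ →
        ∃ (out : TMTB.Outcome) (steps : ℕ),
          (TMTB.estimateTMBT 𝒯 i₀ ε ρ).Returns out steps ∧
          TMTB.IsApproxTMTB ε ρ 𝒯 out.ball ∧
          (steps : ℝ) ≤ C * (n * k * Real.log (n * k + 1) * (1 / ε) *
            (Real.posLog (TMTB.diameter 𝒯 / max (TMTB.minRadius 𝒯) ρ) + k)) ∧
          TMTB.IsApproxTMTB 3 ρ 𝒯 out.estimate ∧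
          (out.ghosts.length : ℝ) ≤ 25 / ε ∧
          (∀ G ∈ out.ghosts, G.length = k) ∧
          (∀ x ∈ TMTB.sausage (𝒯 i₀) out.estimate.radius,
            ∃ G ∈ out.ghosts, ∃ s ∈ G,
              Metric.infDist x s.points ≤ ε * out.estimate.radius / 12) :=
  ⟨30000, by norm_num, fun _ _ 𝒯 i₀ _ _ hk hε hε1 _ hM =>
    TMTB.estimateTMBT_correct 𝒯 i₀ hk hε hε1 hM⟩
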